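/- Fix $r_*>0$. For $\mathbf n,\mathbf m\in\mathbb R^3$ write $\mathbf n\mathbf m=\mathbf n\otimes\mathbf m$, and set $$\mathcal M=\{(\mathbf n,\mathbf m)\in\mathbb S^2\times\mathbb S^2:\mathbf n\cdot\mathbf m=0\},\quad \mathcal N=\{r_*(\mathbf n\mathbf n-\mathbf m\mathbf m):(\mathbf n,\mathbf m)\in\mathcal M\},\quad \mathcal P=\{r_*\mathbf n\mathbf n:\mathbf n\in\mathbb S^2\}\cong\mathbb R\mathbf P^2,$$ with the topology of $3\times 3$ real matrices. Let $\varrho_1,\varrho_2:\mathcal N\to\mathcal P$ be the (well defined, continuous) maps $\varrho_1(r_*(\mathbf n\mathbf n-\mathbf m\mathbf m))=r_*\mathbf n\mathbf n$ and $\varrho_2(r_*(\mathbf n\mathbf n-\mathbf m\mathbf m))=r_*\mathbf m\mathbf m$. For a space $\mathcal X$, $[\mathbb S^1,\mathcal X]$ is the set of free homotopy classes $[L]_{\mathcal X}$ of loops $L\in C^0(\mathbb S^1,\mathcal X)$; for a point $X$ on $L$, $[L]_{\mathcal X,X}\in\pi_1(\mathcal X,X)$ is the class of $L$ run through once counterclockwise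 from a parameter at which $L$ equals $X$. Products in $\pi_1$ are concatenations, the left factor first. Let $Q_8=\{\pm1,\pm \mathrm i,\pm \mathrm j,\pm \mathrm k\}$ be the quaternion group, whose conjugacy classes are $\{1\},\{-1\},\{\pm \mathrm i\},\{\pm \mathrm j\},\{\pm \mathrm k\}$. For every $(\mathbf n,\mathbf m)\in\mathcal M$ and $X=r_*(\mathbf n\mathbf n-\mathbf m\mathbf m)$ there is exactly one group isomorphism $\varphi_X:Q_8\to\pi_1(\mathcal N,X)$ with $\varphi_X(\mathrm i)=[A]_{\mathcal N,X}$ and $\varphi_X(\mathrm j)=[B]_{\mathcal N,X}$, where for $\theta\in[0,2\pi]$ $$A(\theta)=r_*(\mathbf n\mathbf n-\mathbf v\mathbf v),\ \ \mathbf v=\cos\tfrac\theta2\,\mathbf m+\sin\tfrac\theta2\,\mathbf n\times\mathbf m,\qquad B(\theta)=r_*(\mathbf w\mathbf w-\mathbf m\mathbf m),\ \ \mathbf w=\cos\tfrac\theta2\,\mathbf n+\sin\tfrac\theta2\,\mathbf n\times\mathbf m .$$ The set $[\mathbb S^1,\mathcal N]$ has exactly five elements $\mathrm H_0,\mathrm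 H_1,\mathrm H_2,\mathrm H_3,\mathrm H_4$, and $[\mathbb S^1,\mathcal P]$ has exactly two elements $\mathrm h_0,\mathrm h_1$, where $\mathrm H_0$ and $\mathrm h_0$ are the classes of the constant loops, and these elements can be labelled so that the following holds. For every loop $L\in C^0(\mathbb S^1,\mathcal N)$, every point $X$ on $L$ and every $\varphi_X$ as above (for any choice of $(\mathbf n,\mathbf m)$ over $X$), \begin{align*} [L]_{\mathcal N}=\mathrm H_0&\iff\varphi_X^{-1}([L]_{\mathcal N,X})=1,\\ [L]_{\mathcal N}=\mathrm H_1&\iff\varphi_X^{-1}([L]_{\mathcal N,X})\in\{\pm \mathrm i\},\\ [L]_{\mathcal N}=\mathrm H_2&\iff\varphi_X^{-1}([L]_{\mathcal N,X})\in\{\pm \mathrm j\},\\ [L]_{\mathcal N}=\mathrm H_3&\iff\varphi_X^{-1}([L]_{\mathcal N,X})\in\{\pm \mathrm k\},\\ [L]_{\mathcal N}=\mathrm H_4&\iff\varphi_X^{-1}([L]_{\mathcal N,X})=-1. \end{align*} Moreover, if $[L]_{\mathcal N}\neq\mathrm H_0$, then \begin{align*} [L]_{\mathcal N}=\mathrm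 H_1&\iff[\varrho_1(L)]_{\mathcal P}=\mathrm h_0\text{ and }[\varrho_2(L)]_{\mathcal P}=\mathrm h_1,\\ [L]_{\mathcal N}=\mathrm H_2&\iff[\varrho_1(L)]_{\mathcal P}=\mathrm h_1\text{ and }[\varrho_2(L)]_{\mathcal P}=\mathrm h_0,\\ [L]_{\mathcal N}=\mathrm H_3&\iff[\varrho_1(L)]_{\mathcal P}=\mathrm h_1\text{ and }[\varrho_2(L)]_{\mathcal P}=\mathrm h_1,\\ [L]_{\mathcal N}=\mathrm H_4&\iff[\varrho_1(L)]_{\mathcal P}=\mathrm h_0\text{ and }[\varrho_2(L)]_{\mathcal P}=\mathrm h_0. \end{align*} -/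

import Mathlib

open scoped Matrix

noncomputable section

/-! ### Free homotopy classes and fundamental groups -/

/-- Free homotopy of loops `S¹ → X` (no condition on base points), as a setoid. -/
def freeLoopSetoid (X : Type*) [TopologicalSpace X] : Setoid C(Circle, X) :=
  ⟨ContinuousMap.Homotopic, ContinuousMap.Homotopic.equivalence⟩

/-- The set `[S¹, X]` of free homotopy classes of loops in `X`. -/
def FreeLoopClass (X : Type*) [TopologicalSpace X] : Type _ :=
  Quotient (freeLoopSetoid X)

/-- The free homotopy class `[L]_X` of a loop `L`. -/
def freeClass {X : Type*} [TopologicalSpace X] (L : C(Circle, X)) : FreeLoopClass X :=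
  Quotient.mk (freeLoopSetoid X) L

theorem freeClass_eq_iff {X : Type*} [TopologicalSpace X] (L L' : C(Circle, X)) :
    freeClass L = freeClass L' ↔ ContinuousMap.Homotopic L L' :=
  Quotient.eq (r := freeLoopSetoid X)

/-- The fundamental group `π₁(X, x)`, multiplied by concatenation from left to right:
`[γ][δ] = [γ * δ]`, first `γ`, then `δ`. Mathlib's `FundamentalGroup` has the opposite order. -/
abbrev Pi1 (X : Type*) [TopologicalSpace X] (x : X) : Type _ := (FundamentalGroup X x)ᵐᵒᵖ

/-- The class in `π₁(X, x)` of a closed path based at `x`. -/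
def pi1Class {X : Type*} [TopologicalSpace X] {x : X} (γ : Path x x) : Pi1 X x :=
  MulOpposite.op (FundamentalGroup.fromPath (Path.Homotopic.Quotient.mk γ))

theorem pi1Class_trans {X : Type*} [TopologicalSpace X] {x : X} (γ δ : Path x x) :
    pi1Class (γ.trans δ) = pi1Class γ * pi1Class δ := rfl

/-- The loop `L`, run through once counterclockwise starting at the parameter `z`, as a closed
path based at the point `x = L z`. -/
def loopPath {X : Type*} [TopologicalSpace X] (L : C(Circle, X)) (z : Circle) {x : X}
    (hx : L z = x) : Path x x where
  toFun t := L (Circle.exp (2 * Real.pi * t) * z)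
  continuous_toFun := by fun_prop
  source' := by simp [hx]
  target' := by simp [hx]

/-! ### The spaces `𝒩` and `𝒫` -/

/-- The pairs `(n, m)` of orthogonal unit vectors of `ℝ³`. -/
def frameSet : Set ((Fin 3 → ℝ) × (Fin 3 → ℝ)) :=
  {p | p.1 ⬝ᵥ p.1 = 1 ∧ p.2 ⬝ᵥ p.2 = 1 ∧ p.1 ⬝ᵥ p.2 = 0}

/-- The matrix `r (n ⊗ n - m ⊗ m)`. -/
def frameMatrix (r : ℝ) (n m : Fin 3 → ℝ) : Matrix (Fin 3) (Fin 3) ℝ :=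
  r • (Matrix.vecMulVec n n - Matrix.vecMulVec m m)

/-- `𝒩 = {r (n ⊗ n - m ⊗ m) : n, m orthogonal unit vectors}`. -/
def calN (r : ℝ) : Set (Matrix (Fin 3) (Fin 3) ℝ) :=
  {Q | ∃ p ∈ frameSet, Q = frameMatrix r p.1 p.2}

/-- `𝒫 = {r n ⊗ n : n a unit vector}`, a copy of the real projective plane when `r ≠ 0`. -/
def calP (r : ℝ) : Set (Matrix (Fin 3) (Fin 3) ℝ) :=
  {Q | ∃ n : Fin 3 → ℝ, n ⬝ᵥ n = 1 ∧ Q = r • Matrix.vecMulVec n n}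

/-- The point `r (n ⊗ n - m ⊗ m)` of `𝒩`. -/
def framePoint (r : ℝ) (p : frameSet) : calN r :=
  ⟨frameMatrix r p.1.1 p.1.2, p.1, p.2, rfl⟩

theorem frameMatrix_mul_self (r : ℝ) {n m : Fin 3 → ℝ} (h : (n, m) ∈ frameSet) :
    frameMatrix r n m * frameMatrix r n m
      = r ^ 2 • (Matrix.vecMulVec n n + Matrix.vecMulVec m m) := by
  obtain ⟨h1, h2, h3⟩ := h
  simp only at h1 h2 h3
  have h4 : m ⬝ᵥ n = 0 := by rw [dotProduct_comm]; exact h3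
  simp only [frameMatrix, smul_mul_smul_comm, sub_mul, mul_sub, Matrix.vecMulVec_mul_vecMulVec,
    h1, h2, h3, h4]
  simp [pow_two]

/-- `ϱ₁` on matrices: for `Q = r (n ⊗ n - m ⊗ m)` it is `r n ⊗ n` (`rho1Matrix_frameMatrix`). -/
def rho1Matrix (r : ℝ) (Q : Matrix (Fin 3) (Fin 3) ℝ) : Matrix (Fin 3) (Fin 3) ℝ :=
  (2⁻¹ : ℝ) • (r⁻¹ • (Q * Q) + Q)

/-- `ϱ₂` on matrices: for `Q = r (n ⊗ n - m ⊗ m)` it is `r m ⊗ m` (`rho2Matrix_frameMatrix`). -/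
def rho2Matrix (r : ℝ) (Q : Matrix (Fin 3) (Fin 3) ℝ) : Matrix (Fin 3) (Fin 3) ℝ :=
  (2⁻¹ : ℝ) • (r⁻¹ • (Q * Q) - Q)

theorem rho1Matrix_frameMatrix (r : ℝ) {n m : Fin 3 → ℝ} (h : (n, m) ∈ frameSet) :
    rho1Matrix r (frameMatrix r n m) = r • Matrix.vecMulVec n n := by
  rw [rho1Matrix, frameMatrix_mul_self r h]
  ext i j
  by_cases hr : r = 0
  · simp [hr, frameMatrix]
  · simp [frameMatrix]
    field_simp
    ring

theorem rho2Matrix_frameMatrix (r : ℝ) {n m : Fin 3 → ℝ} (h : (n, m) ∈ frameSet) :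
    rho2Matrix r (frameMatrix r n m) = r • Matrix.vecMulVec m m := by
  rw [rho2Matrix, frameMatrix_mul_self r h]
  ext i j
  by_cases hr : r = 0
  · simp [hr, frameMatrix]
  · simp [frameMatrix]
    field_simp
    ring

/-- The continuous projection `ϱ₁ : 𝒩 → 𝒫`, `r (n ⊗ n - m ⊗ m) ↦ r n ⊗ n`. -/
def rho1 (r : ℝ) : C(calN r, calP r) where
  toFun Q := ⟨rho1Matrix r Q.1, by
    obtain ⟨Q, p, hp, rfl⟩ := Q
    exact ⟨p.1, hp.1, rho1Matrix_frameMatrix r hp⟩⟩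
  continuous_toFun := by
    unfold rho1Matrix
    fun_prop

/-- The continuous projection `ϱ₂ : 𝒩 → 𝒫`, `r (n ⊗ n - m ⊗ m) ↦ r m ⊗ m`. -/
def rho2 (r : ℝ) : C(calN r, calP r) where
  toFun Q := ⟨rho2Matrix r Q.1, by
    obtain ⟨Q, p, hp, rfl⟩ := Q
    exact ⟨p.2, hp.2.1, rho2Matrix_frameMatrix r hp⟩⟩
  continuous_toFun := by
    unfold rho2Matrix
    fun_prop

theorem rho1_framePoint (r : ℝ) (p : frameSet) :
    (rho1 r (framePoint r p) : Matrix (Fin 3) (Fin 3) ℝ) = r • Matrix.vecMulVec p.1.1 p.1.1 :=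
  rho1Matrix_frameMatrix r p.2

theorem rho2_framePoint (r : ℝ) (p : frameSet) :
    (rho2 r (framePoint r p) : Matrix (Fin 3) (Fin 3) ℝ) = r • Matrix.vecMulVec p.1.2 p.1.2 :=
  rho2Matrix_frameMatrix r p.2

/-! ### The quaternion group and the isomorphisms `φ_X : Q₈ → π₁(𝒩, X)` -/

/-- The quaternion group `Q₈ = {±1, ±i, ±j, ±k}`. -/
abbrev Q8 : Type := QuaternionGroup 2

/-- The element `-1` of `Q₈`. -/
def Q8.negOne : Q8 := QuaternionGroup.a 2

/-- The element `i` of `Q₈`. -/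
def Q8.i : Q8 := QuaternionGroup.a 1

/-- The element `j` of `Q₈`. -/
def Q8.j : Q8 := QuaternionGroup.xa 0

/-- The element `k = ij` of `Q₈`. -/
def Q8.k : Q8 := Q8.i * Q8.j

theorem Q8.relations :
    Q8.i * Q8.i = Q8.negOne ∧ Q8.j * Q8.j = Q8.negOne ∧ Q8.k * Q8.k = Q8.negOne ∧
      Q8.i * Q8.j * Q8.k = Q8.negOne ∧ Q8.negOne ≠ 1 ∧ Q8.negOne * Q8.negOne = 1 := by
  decide

theorem Q8.elements (g : Q8) :
    g = 1 ∨ g = Q8.negOne ∨ (g = Q8.i ∨ g = Q8.negOne * Q8.i) ∨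
      (g = Q8.j ∨ g = Q8.negOne * Q8.j) ∨ (g = Q8.k ∨ g = Q8.negOne * Q8.k) := by
  revert g
  decide

/-- The conjugacy classes of `Q₈` are `{1}`, `{-1}`, `{±i}`, `{±j}`, `{±k}`. -/
theorem Q8.isConj_iff (g g' : Q8) :
    IsConj g g' ↔ g = g' ∨ (g = Q8.negOne * g' ∧ g' ≠ 1 ∧ g' ≠ Q8.negOne) := by
  rw [_root_.isConj_iff]
  revert g g'
  decide

/-- For a frame `(n, m)` and `p = n × m`, the pair `(n, cos θ m + sin θ p)` is again a frame. -/
theorem frameSet_rotate_snd {n m : Fin 3 → ℝ} (h : (n, m) ∈ frameSet) (θ : ℝ) :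
    (n, Real.cos θ • m + Real.sin θ • (crossProduct n m)) ∈ frameSet := by
  obtain ⟨h1, h2, h3⟩ := h
  have hs := Real.sin_sq_add_cos_sq θ
  simp only at h1 h2 h3
  have h4 : m ⬝ᵥ n = 0 := by rw [dotProduct_comm]; exact h3
  have h5 : crossProduct n m ⬝ᵥ m = 0 := by rw [dotProduct_comm]; exact dot_cross_self n m
  have h6 : crossProduct n m ⬝ᵥ crossProduct n m = 1 := by
    rw [cross_dot_cross, h1, h2, h3, h4]; ring
  refine ⟨h1, ?_, ?_⟩
  · simp [h2, h5, h6, dot_cross_self]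
    linarith
  · simp [h3, dot_self_cross]

/-- For a frame `(n, m)` and `p = n × m`, the pair `(cos θ n + sin θ p, m)` is again a frame. -/
theorem frameSet_rotate_fst {n m : Fin 3 → ℝ} (h : (n, m) ∈ frameSet) (θ : ℝ) :
    (Real.cos θ • n + Real.sin θ • (crossProduct n m), m) ∈ frameSet := by
  obtain ⟨h1, h2, h3⟩ := h
  have hs := Real.sin_sq_add_cos_sq θ
  simp only at h1 h2 h3
  have h4 : m ⬝ᵥ n = 0 := by rw [dotProduct_comm]; exact h3
  have h5 : crossProduct n m ⬝ᵥ m = 0 := by rw [dotProduct_comm]; exact dot_cross_self n m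
  have h7 : crossProduct n m ⬝ᵥ n = 0 := by rw [dotProduct_comm]; exact dot_self_cross n m
  have h6 : crossProduct n m ⬝ᵥ crossProduct n m = 1 := by
    rw [cross_dot_cross, h1, h2, h3, h4]; ring
  refine ⟨?_, h2, ?_⟩
  · simp [h1, h7, h6, dot_self_cross]
    linarith
  · simp [h3, h5]

/-- The loop `A(θ) = r (n ⊗ n - v(θ) ⊗ v(θ))`, `v(θ) = cos (θ/2) m + sin (θ/2) (n × m)`,
`θ = 2πt`, based at `r (n ⊗ n - m ⊗ m)`. -/
def loopA (r : ℝ) (p : frameSet) : Path (framePoint r p) (framePoint r p) where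
  toFun t := framePoint r ⟨_, frameSet_rotate_snd p.2 (Real.pi * t)⟩
  continuous_toFun := by
    unfold framePoint frameMatrix
    refine Continuous.subtype_mk ?_ _
    refine continuous_matrix fun a b => ?_
    simp only [Matrix.smul_apply, Matrix.sub_apply, Matrix.vecMulVec_apply, Pi.add_apply,
      Pi.smul_apply, smul_eq_mul]
    fun_prop
  source' := by simp
  target' := by simp [framePoint, frameMatrix, Matrix.vecMulVec_neg, Matrix.neg_vecMulVec]

/-- The loop `B(θ) = r (w(θ) ⊗ w(θ) - m ⊗ m)`, `w(θ) = cos (θ/2) n + sin (θ/2) (n × m)`,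
`θ = 2πt`, based at `r (n ⊗ n - m ⊗ m)`. -/
def loopB (r : ℝ) (p : frameSet) : Path (framePoint r p) (framePoint r p) where
  toFun t := framePoint r ⟨_, frameSet_rotate_fst p.2 (Real.pi * t)⟩
  continuous_toFun := by
    unfold framePoint frameMatrix
    refine Continuous.subtype_mk ?_ _
    refine continuous_matrix fun a b => ?_
    simp only [Matrix.smul_apply, Matrix.sub_apply, Matrix.vecMulVec_apply, Pi.add_apply,
      Pi.smul_apply, smul_eq_mul]
    fun_prop
  source' := by simp
  target' := by simp [framePoint, frameMatrix, Matrix.vecMulVec_neg, Matrix.neg_vecMulVec]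

/-- `φ : Q₈ → π₁(𝒩, X)` is the isomorphism attached to the frame `(n, m)` over
`X = r (n ⊗ n - m ⊗ m)`: it sends `i` to the class of `A` and `j` to the class of `B`. -/
def IsFrameIso (r : ℝ) (p : frameSet) (φ : Q8 ≃* Pi1 (calN r) (framePoint r p)) : Prop :=
  φ Q8.i = pi1Class (loopA r p) ∧ φ Q8.j = pi1Class (loopB r p)

end

/-! A unit quaternion `g` rotates `ℝ³` by `v ↦ g̅ v g` and so carries the standard frame to another
one, `quatFrame g`. Every frame arises in this way, from exactly two quaternions `±g`. Passing from
frames to `𝒩` also forgets the signs of `n` and `m`, and left multiplication by the copy of `Q₈` in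
`S³` realises all these ambiguities. Hence `quatCover : S³ → 𝒩` is the quotient by a free action of
`Q₈`. As `S³` is simply connected, `π₁(𝒩, X) ≅ Q₈`. Explicit half-angle lifts of `A` and `B`
identify this isomorphism with `φ_X` (`isFrameIso_pi1Equiv`).

Free homotopy classes are read off from holonomy: a lift of a loop ends at `g` times its start,
where `g` is determined up to conjugacy and is invariant under free homotopy. Conversely, equal
holonomy implies free homotopy, because one lift can be dragged equivariantly to the start of the
other and the total space is simply connected (`freeClass_eq_iff_isConj`). So the classes of loops
correspond to conjugacy classes: five for `Q₈`, and two for the group `{±1}` of the cover `S² → 𝒫`.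

The maps `ϱ₁`, `ϱ₂` lift to equivariant maps `S³ → S²`, so they turn holonomy `q` into the signs
`Q8.fstSign q`, `Q8.sndSign q`. These are `(+,-)`, `(-,+)`, `(-,-)` on `±i`, `±j`, `±k`, and `(+,+)`
on both `1` and `-1`; this is why `H₀` must be excluded in the last part. -/

/-! ### Spheres are simply connected -/

section SphereSimplyConnected

open Metric unitInterval Module

variable {V : Type*} [NormedAddCommGroup V] [InnerProductSpace ℝ V]

/-- Two paths in the unit sphere that are nowhere antipodal are homotopic. -/
theorem sphere_homotopic_of_forall_ne_neg {x y : sphere (0 : V) 1} (γ δ : Path x y)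
    (h : ∀ t, (γ t : V) ≠ -(δ t : V)) : γ.Homotopic δ := by
  have hne : ∀ s t : I, (1 - (s : ℝ)) • (γ t : V) + (s : ℝ) • (δ t : V) ≠ 0 := by
    intro s t h0
    have h1 : (1 - (s : ℝ)) • (γ t : V) = -((s : ℝ) • (δ t : V)) := eq_neg_of_add_eq_zero_left h0
    have h2 := congrArg norm h1
    have hγ : ‖(γ t : V)‖ = 1 := by simp
    have hδ : ‖(δ t : V)‖ = 1 := by simp
    rw [norm_neg, norm_smul, norm_smul, hγ, hδ, Real.norm_of_nonneg (by linarith [s.2.2]),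
      Real.norm_of_nonneg s.2.1] at h2
    -- A segment joining two unit vectors can meet the origin only at its midpoint, and then the
    -- vectors are antipodal.
    have hs : (s : ℝ) = 1 / 2 := by linarith
    rw [hs, ← smul_neg, sub_half] at h1
    exact h t (smul_right_injective V (by norm_num : (1 / 2 : ℝ) ≠ 0) h1)
  have hnorm : ∀ v : V, v ≠ 0 → ‖v‖⁻¹ • v ∈ sphere (0 : V) 1 := by
    intro v hv
    simp [norm_smul, hv]
  have hunit : ∀ v : sphere (0 : V) 1, ‖(v : V)‖ = 1 := fun v => by simp
  refine ⟨⟨⟨⟨fun p => ⟨_, hnorm _ (hne p.1 p.2)⟩, ?_⟩, ?_, ?_⟩, ?_⟩⟩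
  · refine Continuous.subtype_mk ?_ _
    refine Continuous.smul (Continuous.inv₀ (by fun_prop) fun p => ?_) (by fun_prop)
    exact norm_ne_zero_iff.2 (hne p.1 p.2)
  · intro t
    ext
    simp [hunit]
  · intro t
    ext
    simp [hunit]
  · rintro s t (rfl | rfl)
    · ext
      simp only [ContinuousMap.coe_mk, Path.source, Path.coe_toContinuousMap]
      rw [← add_smul]
      simp [hunit]
    · ext
      simp only [ContinuousMap.coe_mk, Path.target, Path.coe_toContinuousMap]
      rw [← add_smul]
      simp [hunit]

/-- Stereographic projection from `v` identifies the complement with a real vector space, which is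
contractible. -/
theorem isSimplyConnected_sphere_compl_singleton (v : sphere (0 : V) 1) :
    IsSimplyConnected ({v}ᶜ : Set (sphere (0 : V) 1)) := by
  have hv : ‖(v : V)‖ = 1 := by simp
  have e : (stereographic hv).source ≃ₜ (stereographic hv).target :=
    (stereographic hv).toHomeomorphSourceTarget
  rw [stereographic_source, stereographic_target] at e
  have := (e.trans (Homeomorph.Set.univ _)).contractibleSpace
  exact SimplyConnectedSpace.ofContractible ({v}ᶜ : Set (sphere (0 : V) 1))

/-- Every closed path in a sphere of dimension at least two is homotopic to one that omits
a point. -/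
theorem exists_homotopic_forall_ne [FiniteDimensional ℝ V] (hV : 2 < finrank ℝ V)
    {x : sphere (0 : V) 1} (γ : Path x x) :
    ∃ (δ : Path x x) (v : sphere (0 : V) 1), γ.Homotopic δ ∧ ∀ t, δ t ≠ v := by
  have hunit : ∀ v : sphere (0 : V) 1, ‖(v : V)‖ = 1 := fun v => by simp
  obtain ⟨q, hq, hqd, -⟩ := Continuous.exists_contDiff_approx (E := ℝ) (F := V)
    (f := fun t => (γ.extend t : V)) (ε := fun _ => 1 / 4) 1
    (by fun_prop) continuous_const (fun _ => by norm_num)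
  have hq0 : ‖(x : V) - q 0‖ < 1 / 4 := by
    have := hqd 0
    rwa [dist_comm, dist_eq_norm, Path.extend_zero] at this
  have hq1 : ‖(x : V) - q 1‖ < 1 / 4 := by
    have := hqd 1
    rwa [dist_comm, dist_eq_norm, Path.extend_one] at this
  -- The affine term restores the end points lost in the approximation. It costs at most another
  -- `1/4`, so `Q` stays within `1/2` of `γ`; hence it avoids `0`, and its normalisation is never
  -- antipodal to `γ`.
  set Q : ℝ → V := fun t => q t + ((1 - t) • ((x : V) - q 0) + t • ((x : V) - q 1)) with hQ
  have hQc : ContDiff ℝ 1 Q := by fun_prop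
  have hQγ : ∀ t : I, ‖Q t - (γ t : V)‖ < 1 / 2 := by
    intro t
    have h1 : ‖q t - (γ t : V)‖ < 1 / 4 := by
      have := hqd t
      rwa [dist_eq_norm, Path.extend_apply γ t.2] at this
    have h2 : ‖(1 - (t : ℝ)) • ((x : V) - q 0) + (t : ℝ) • ((x : V) - q 1)‖ ≤ 1 / 4 := by
      refine (norm_add_le _ _).trans ?_
      rw [norm_smul, norm_smul, Real.norm_of_nonneg (by linarith [t.2.2] : 0 ≤ 1 - (t : ℝ)),
        Real.norm_of_nonneg t.2.1]
      nlinarith [t.2.1, t.2.2]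
    calc ‖Q t - (γ t : V)‖
        = ‖(q t - (γ t : V)) + ((1 - (t : ℝ)) • ((x : V) - q 0) + (t : ℝ) • ((x : V) - q 1))‖ := by
          congr 1
          simp only [hQ]
          abel
      _ < 1 / 2 := by 
          refine (norm_add_le _ _).trans_lt ?_
          linarith
  have hQ0 : ∀ t : I, Q t ≠ 0 := by
    intro t h0
    have := hQγ t
    rw [h0, zero_sub, norm_neg, hunit] at this
    norm_num at this
  -- The cone over the curve `Q` is a `C¹` image of `ℝ²`, so in dimension above two it misses some
  -- `w`. The direction of `w` is the omitted point.
  have hdense : Dense (Set.range fun p : ℝ × ℝ => p.2 • Q p.1)ᶜ := by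
    refine ContDiff.dense_compl_range_of_finrank_lt_finrank (by fun_prop) ?_
    simpa using hV
  obtain ⟨w, hw⟩ := hdense.nonempty
  have hw0 : w ≠ 0 := by
    rintro rfl
    exact hw ⟨(0, 0), by simp⟩
  refine ⟨⟨⟨fun t => ⟨‖Q t‖⁻¹ • Q t, by simp [norm_smul, hQ0 t]⟩, ?_⟩, ?_, ?_⟩,
    ⟨‖w‖⁻¹ • w, by simp [norm_smul, hw0]⟩, sphere_homotopic_of_forall_ne_neg _ _ ?_, ?_⟩
  · refine Continuous.subtype_mk ?_ _
    have := hQc.continuous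
    refine Continuous.smul (Continuous.inv₀ (by fun_prop) fun p => ?_) (by fun_prop)
    exact norm_ne_zero_iff.2 (hQ0 p)
  · ext
    simp [hQ, hunit]
  · ext
    simp [hQ, hunit]
  · intro t h
    have h1 : Q t = -(‖Q t‖ • (γ t : V)) := by
      rw [h]
      simp [smul_smul, hQ0 t]
    have h2 : Q t - (γ t : V) = -((‖Q t‖ + 1) • (γ t : V)) := by
      rw [add_smul, one_smul, neg_add, ← h1, sub_eq_add_neg]
    have h3 := hQγ t
    rw [h2, norm_neg, norm_smul, hunit, Real.norm_of_nonneg (by positivity)] at h3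
    linarith [norm_nonneg (Q t)]
  · intro t h
    have h1 : ‖Q t‖⁻¹ • Q t = ‖w‖⁻¹ • w := congrArg Subtype.val h
    apply hw
    refine ⟨(t, ‖w‖ * ‖Q t‖⁻¹), ?_⟩
    simp only
    rw [mul_smul, h1, smul_smul, mul_inv_cancel₀ (norm_ne_zero_iff.2 hw0), one_smul]

theorem simplyConnectedSpace_sphere [FiniteDimensional ℝ V] (hV : 2 < finrank ℝ V) :
    SimplyConnectedSpace (sphere (0 : V) 1) := by
  rw [simply_connected_iff_loops_nullhomotopic]
  refine ⟨isPathConnected_iff_pathConnectedSpace.1 (isPathConnected_sphere ?_ 0 zero_le_one),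
    fun x γ => ?_⟩
  · rw [← finrank_eq_rank]
    exact_mod_cast (by omega : 1 < finrank ℝ V)
  · obtain ⟨δ, v, hγδ, hδ⟩ := exists_homotopic_forall_ne hV γ
    obtain ⟨F, -⟩ := (isSimplyConnected_iff_exists_homotopy_refl_forall_mem.1
      (isSimplyConnected_sphere_compl_singleton v)).2 x δ hδ
    exact hγδ.trans ⟨F⟩

end SphereSimplyConnected

/-! ### Holonomy of loops in the base of a quotient covering map -/

section Holonomy

open unitInterval Topology

/-- The parametrization `t ↦ exp (2πit)` of the circle by the unit interval. -/
noncomputable def circleParam : C(I, Circle) := ⟨fun t => Circle.exp (2 * Real.pi * t), by fun_prop⟩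

theorem circleParam_apply (t : I) : circleParam t = Circle.exp (2 * Real.pi * t) := rfl

@[simp] theorem circleParam_zero : circleParam 0 = 1 := by simp [circleParam_apply]

@[simp] theorem circleParam_one : circleParam 1 = 1 := by simp [circleParam_apply]

theorem circleParam_surjective : Function.Surjective circleParam := by
  intro z
  refine ⟨⟨Int.fract ((z : ℂ).arg / (2 * Real.pi)), Int.fract_nonneg _, (Int.fract_lt_one _).le⟩, ?_⟩
  rw [circleParam_apply]
  conv_rhs => rw [← Circle.exp_arg z]
  rw [Circle.exp_eq_exp]
  refine ⟨-⌊(z : ℂ).arg / (2 * Real.pi)⌋, ?_⟩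
  have := Real.pi_pos
  simp only [Int.fract]
  push_cast
  field_simp
  ring

theorem eq_or_of_circleParam_eq {s t : I} (h : circleParam s = circleParam t) :
    s = t ∨ (s = 0 ∧ t = 1) ∨ (s = 1 ∧ t = 0) := by
  rw [circleParam_apply, circleParam_apply, Circle.exp_eq_exp] at h
  obtain ⟨m, hm⟩ := h
  have hst : (s : ℝ) = t + m := by
    have := Real.pi_pos
    have h2 : 2 * Real.pi * ((s : ℝ) - (t + m)) = 0 := by linarith
    rcases mul_eq_zero.1 h2 with h3 | h3 <;> linarith
  have h1 : (m : ℝ) ≤ 1 := by linarith [s.2.2, t.2.1]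
  have h2 : (-1 : ℝ) ≤ m := by linarith [s.2.1, t.2.2]
  have h1' : m ≤ 1 := by exact_mod_cast h1
  have h2' : -1 ≤ m := by exact_mod_cast h2
  obtain rfl | rfl | rfl : m = -1 ∨ m = 0 ∨ m = 1 := by omega
  · refine Or.inr (Or.inl ⟨Subtype.ext ?_, Subtype.ext ?_⟩) <;> push_cast at * <;>
      linarith [s.2.1, t.2.2]
  · exact Or.inl (Subtype.ext (by simpa using hst))
  · refine Or.inr (Or.inr ⟨Subtype.ext ?_, Subtype.ext ?_⟩) <;> push_cast at * <;>
      linarith [s.2.2, t.2.1]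

/-- A continuous surjection from a compact space to a Hausdorff one is a closed map. The factor `Y`
is carried along because homotopies (`Y = I`), not only loops, have to descend to the circle. -/
theorem isQuotientMap_prodMap_circleParam (Y : Type*) [TopologicalSpace Y] [CompactSpace Y]
    [T2Space Y] : IsQuotientMap (Prod.map (id : Y → Y) circleParam) :=
  (Continuous.isClosedMap (by fun_prop)).isQuotientMap (by fun_prop)
    (Function.surjective_id.prodMap circleParam_surjective)

variable {E X G : Type*} [TopologicalSpace E] [TopologicalSpace X]

/-- A family of closed paths descends to a family of loops. -/
theorem exists_family_of_closed (Y : Type*) [TopologicalSpace Y] [CompactSpace Y] [T2Space Y]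
    (K : C(Y × I, X)) (hK : ∀ y, K (y, 0) = K (y, 1)) :
    ∃ L : C(Y × Circle, X), ∀ y t, L (y, circleParam t) = K (y, t) := by
  have hq := isQuotientMap_prodMap_circleParam Y
  let f : C(Y × I, Y × Circle) := ⟨Prod.map id circleParam, by fun_prop⟩
  have hf : IsQuotientMap f := hq
  have hfac : ∀ a b, f a = f b → K a = K b := by
    rintro ⟨y, s⟩ ⟨y', t⟩ h
    obtain ⟨h1, h2⟩ := Prod.ext_iff.1 h
    obtain rfl : y = y' := h1
    rcases eq_or_of_circleParam_eq h2 with h3 | ⟨h3, h4⟩ | ⟨h3, h4⟩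
    · rw [h3]
    · rw [h3, h4, hK]
    · rw [h3, h4, hK]
  refine ⟨hf.lift K hfac, fun y t => ?_⟩
  have := hf.lift_comp K hfac
  exact congrArg (fun g : C(Y × I, X) => g (y, t)) this

theorem exists_loop_of_closed (K : C(I, X)) (hK : K 0 = K 1) :
    ∃ L : C(Circle, X), ∀ t, L (circleParam t) = K t := by
  obtain ⟨L, hL⟩ := exists_family_of_closed Unit (K.comp ⟨Prod.snd, continuous_snd⟩)
    (fun _ => hK)
  exact ⟨L.comp ⟨fun z => ((), z), by fun_prop⟩, fun t => hL () t⟩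

theorem homotopic_of_square {L L' : C(Circle, X)} (K : C(I × I, X))
    (hK : ∀ s, K (s, 0) = K (s, 1)) (h0 : ∀ t, K (0, t) = L (circleParam t))
    (h1 : ∀ t, K (1, t) = L' (circleParam t)) : L.Homotopic L' := by
  obtain ⟨M, hM⟩ := exists_family_of_closed I K hK
  refine ⟨⟨M, fun z => ?_, fun z => ?_⟩⟩
  · obtain ⟨t, rfl⟩ := circleParam_surjective z
    exact (hM 0 t).trans (h0 t)
  · obtain ⟨t, rfl⟩ := circleParam_surjective z
    exact (hM 1 t).trans (h1 t)

variable [Group G] [MulAction G E]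

/-- The loop `L` in the base of `p : E → X` has holonomy `g` if it has a lift `F` to `E`
whose end point is `g` times its starting point. -/
def HasHolonomy (p : E → X) (L : C(Circle, X)) (g : G) : Prop :=
  ∃ F : C(I, E), (∀ t, p (F t) = L (circleParam t)) ∧ F 1 = g • F 0

theorem HasHolonomy.map {p : E → X} {E' X' G' : Type*} [TopologicalSpace E'] [TopologicalSpace X']
    [Group G'] [MulAction G' E'] {p' : E' → X'} {L : C(Circle, X)} {g : G}
    (h : HasHolonomy p L g) (f : C(X, X')) (f' : C(E, E')) (χ : G → G')
    (hp : ∀ e, p' (f' e) = f (p e)) (hχ : ∀ (g : G) e, f' (g • e) = χ g • f' e) :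
    HasHolonomy p' (f.comp L) (χ g) := by
  obtain ⟨F, hF, hF1⟩ := h
  refine ⟨f'.comp F, fun t => ?_, ?_⟩
  · simp [hp, hF]
  · simp [hF1, hχ]

theorem hasHolonomy_const (p : E → X) (e : E) :
    HasHolonomy p (ContinuousMap.const Circle (p e)) (1 : G) :=
  ⟨ContinuousMap.const I e, by simp, by simp⟩

/-- Project a path from `e` to `g • e`. -/
theorem exists_hasHolonomy_eq [PathConnectedSpace E] {p : E → X} (hp : IsQuotientCoveringMap p G)
    (g : G) : ∃ L : C(Circle, X), HasHolonomy p L g := by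
  obtain ⟨e⟩ : Nonempty E := inferInstance
  let c : Path e (g • e) := PathConnectedSpace.somePath _ _
  obtain ⟨L, hL⟩ := exists_loop_of_closed
    ((⟨p, hp.isCoveringMap.continuous⟩ : C(E, X)).comp c.toContinuousMap) (by simp [hp.map_smul])
  exact ⟨L, c.toContinuousMap, fun t => (hL t).symm, by simp⟩

namespace IsQuotientCoveringMap

variable {p : E → X} (hp : IsQuotientCoveringMap p G) {L L' : C(Circle, X)} {g g' : G}
include hp

theorem exists_hasHolonomy (L : C(Circle, X)) : ∃ g : G, HasHolonomy p L g := by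
  obtain ⟨e, he⟩ := hp.surjective (L 1)
  obtain ⟨F, hF, hF0⟩ := hp.isCoveringMap.exists_path_lifts (L.comp circleParam) e (by simp [he])
  have h1 : p (F 1) = p (F 0) := by
    have h2 := congrFun hF 1
    have h3 := congrFun hF 0
    simp only [Function.comp_apply, ContinuousMap.comp_apply, circleParam_zero,
      circleParam_one] at h2 h3
    rw [h2, h3]
  obtain ⟨g, hg⟩ := hp.apply_eq_iff_mem_orbit.1 h1
  exact ⟨g, F, fun t => congrFun hF t, hg.symm⟩

/-- Two lifts of the same loop differ by a single group element `k`, by uniqueness of lifts;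
translating by `k` conjugates the holonomy. -/
theorem smul_lift_eq_of_hasHolonomy {F : C(I, E)} (hF : ∀ t, p (F t) = L (circleParam t))
    (h : HasHolonomy p L g) : ∃ k : G, F 1 = (k * g * k⁻¹) • F 0 := by
  obtain ⟨F', hF', hF1⟩ := h
  obtain ⟨k, hk⟩ := hp.apply_eq_iff_mem_orbit.1 ((hF 0).trans (hF' 0).symm)
  have hc := hp.continuous_const_smul k
  have heq : (F : I → E) = fun t => k • F' t :=
    hp.isCoveringMap.eq_of_comp_eq F.continuous (hc.comp F'.continuous)
      (funext fun t => by simp [hp.map_smul, hF, hF']) 0 hk.symm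
  refine ⟨k, ?_⟩
  rw [heq]
  simp [hF1, mul_smul]

theorem hasHolonomy_isConj (h : HasHolonomy p L g) (h' : HasHolonomy p L g') : IsConj g g' := by
  obtain ⟨F', hF', hF1⟩ := h'
  obtain ⟨k, hk⟩ := hp.smul_lift_eq_of_hasHolonomy hF' h
  have := hp.isCancelSMul
  exact isConj_iff.2 ⟨k, IsCancelSMul.right_cancel _ _ (F' 0) (hk.symm.trans hF1)⟩

theorem hasHolonomy_of_isConj (h : HasHolonomy p L g) (hg : IsConj g g') :
    HasHolonomy p L g' := by
  obtain ⟨k, rfl⟩ := isConj_iff.1 hg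
  obtain ⟨F, hF, hF1⟩ := h
  refine ⟨⟨fun t => k • F t, (hp.continuous_const_smul k).comp F.continuous⟩, fun t => ?_, ?_⟩
  · simp [hp.map_smul, hF]
  · simp [hF1, mul_smul]

theorem hasHolonomy_of_homotopic (h : HasHolonomy p L g) (hL : L.Homotopic L') :
    HasHolonomy p L' g := by
  obtain ⟨F, hF, hF1⟩ := h
  obtain ⟨H⟩ := hL
  let K : C(I × I, X) := ⟨fun q => H (q.1, circleParam q.2), by fun_prop⟩
  have hK0 : ∀ t, K (0, t) = p (F t) := fun t => by simp [K, hF]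
  let M := hp.isCoveringMap.liftHomotopy K F hK0
  have hM : ∀ q, p (M q) = K q := congrFun (hp.isCoveringMap.liftHomotopy_lifts K F hK0)
  have hM0 : ∀ t, M (0, t) = F t := hp.isCoveringMap.liftHomotopy_zero K F hK0
  -- Both edges lift the same path in `X` and agree at `s = 0`, so the relation between end and
  -- start persists throughout the homotopy.
  have heq : (fun s : I => M (s, 1)) = fun s => g • M (s, 0) :=
    hp.isCoveringMap.eq_of_comp_eq (by fun_prop)
      ((hp.continuous_const_smul g).comp (by fun_prop))
      (funext fun s => by simp [hp.map_smul, hM, K]) 0 (by simp only [hM0, hF1])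
  refine ⟨⟨fun t => M (1, t), by fun_prop⟩, fun t => ?_, congrFun heq 1⟩
  simp [hM, K]

/-- Rotating the circle along a path from `z` to `1` is a free homotopy, so the starting parameter
does not matter. -/
theorem hasHolonomy_of_loopPath {z : Circle} {x : X} (hx : L z = x) {e : E} (F : C(I, E))
    (hF : ∀ t, p (F t) = loopPath L z hx t) (hF0 : F 0 = e) (hF1 : F 1 = g • e) :
    HasHolonomy p L g := by
  let c : Path z 1 := PathConnectedSpace.somePath _ _
  refine hp.hasHolonomy_of_homotopic (L := L.comp ⟨fun w => w * z, by fun_prop⟩)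
    ⟨F, hF, hF1.trans (by rw [hF0])⟩ ⟨⟨⟨fun q => L (q.2 * c q.1), by fun_prop⟩, ?_, ?_⟩⟩
  · intro w
    simp
  · intro w
    simp

/-- If `E` is simply connected, and any point of `E` can be moved to any other one by an
equivariant isotopy, then loops with the same holonomy are freely homotopic. -/
theorem homotopic_of_hasHolonomy [SimplyConnectedSpace E]
    (hmove : ∀ e e' : E, ∃ Ψ : C(I × E, E), (∀ x, Ψ (0, x) = x) ∧ Ψ (1, e) = e' ∧
      ∀ (s : I) (g : G) (x : E), Ψ (s, g • x) = g • Ψ (s, x))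
    (h : HasHolonomy p L g) (h' : HasHolonomy p L' g) : L.Homotopic L' := by
  obtain ⟨F, hF, hF1⟩ := h
  obtain ⟨F', hF', hF1'⟩ := h'
  obtain ⟨Ψ, hΨ0, hΨ1, hΨ⟩ := hmove (F 0) (F' 0)
  have hpc := hp.isCoveringMap.continuous
  let K : C(I × I, X) := ⟨fun q => p (Ψ (q.1, F q.2)), by fun_prop⟩
  -- `L''` is `L` dragged by the isotopy until its lift starts at `F' 0`. Equivariance keeps every
  -- intermediate path closed in `X`.
  obtain ⟨L'', hL''⟩ := exists_loop_of_closed (K.comp ⟨fun t => (1, t), by fun_prop⟩)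
    (by simp [K, hF1, hΨ, hp.map_smul])
  have h1 : L.Homotopic L'' := by
    refine homotopic_of_square K (fun s => ?_) (fun t => ?_) (fun t => ?_)
    · simp [K, hF1, hΨ, hp.map_smul]
    · simp [K, hΨ0, hF]
    · rw [hL'']
      rfl
  refine h1.trans ?_
  -- The two lifts now share both end points, since they have the same start and the same holonomy.
  let γ : Path (F' 0) (F' 1) := ⟨⟨fun t => Ψ (1, F t), by fun_prop⟩, by simp [hΨ1],
    by simp [hF1, hF1', hΨ, hΨ1]⟩
  let γ' : Path (F' 0) (F' 1) := ⟨F', rfl, rfl⟩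
  obtain ⟨M⟩ := SimplyConnectedSpace.paths_homotopic γ γ'
  refine homotopic_of_square ⟨fun q => p (M q), by fun_prop⟩ (fun s => ?_) (fun t => ?_)
    (fun t => ?_)
  · simp [hF1', hp.map_smul]
  · rw [hL'']
    simp [K, γ]
  · simp [γ', hF']

theorem freeClass_eq_iff_isConj [SimplyConnectedSpace E]
    (hmove : ∀ e e' : E, ∃ Ψ : C(I × E, E), (∀ x, Ψ (0, x) = x) ∧ Ψ (1, e) = e' ∧
      ∀ (s : I) (g : G) (x : E), Ψ (s, g • x) = g • Ψ (s, x))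
    (h : HasHolonomy p L g) (h' : HasHolonomy p L' g') :
    freeClass L = freeClass L' ↔ IsConj g g' := by
  rw [freeClass_eq_iff]
  constructor
  · intro hL
    exact hp.hasHolonomy_isConj (hp.hasHolonomy_of_homotopic h hL) h'
  · intro hg
    exact hp.homotopic_of_hasHolonomy hmove (hp.hasHolonomy_of_isConj h hg) h'

end IsQuotientCoveringMap

end Holonomy

/-! ### Unit quaternions and frames -/

section QuaternionFrames

open Quaternion

/-- The pure quaternion with the given imaginary part. -/
noncomputable def vecQuat (v : Fin 3 → ℝ) : ℍ[ℝ] := ⟨0, v 0, v 1, v 2⟩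

@[simp] theorem vecQuat_re (v : Fin 3 → ℝ) : (vecQuat v).re = 0 := rfl

@[simp] theorem vecQuat_imI (v : Fin 3 → ℝ) : (vecQuat v).imI = v 0 := rfl

@[simp] theorem vecQuat_imJ (v : Fin 3 → ℝ) : (vecQuat v).imJ = v 1 := rfl

@[simp] theorem vecQuat_imK (v : Fin 3 → ℝ) : (vecQuat v).imK = v 2 := rfl

theorem vecQuat_injective : Function.Injective vecQuat := by
  intro v w h
  ext i
  fin_cases i
  exacts [congrArg (fun q : ℍ[ℝ] => q.imI) h, congrArg (fun q : ℍ[ℝ] => q.imJ) h,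
    congrArg (fun q : ℍ[ℝ] => q.imK) h]

theorem vecQuat_add (v w : Fin 3 → ℝ) : vecQuat (v + w) = vecQuat v + vecQuat w := by
  ext <;> simp

theorem vecQuat_smul (c : ℝ) (v : Fin 3 → ℝ) : vecQuat (c • v) = c • vecQuat v := by
  ext <;> simp

theorem vecQuat_mul (v w : Fin 3 → ℝ) :
    vecQuat v * vecQuat w = -((v ⬝ᵥ w : ℝ) : ℍ[ℝ]) + vecQuat (crossProduct v w) := by
  ext <;> simp [cross_apply, dotProduct, Fin.sum_univ_three] <;> ring

theorem vecQuat_mul_self {v : Fin 3 → ℝ} (hv : v ⬝ᵥ v = 1) : vecQuat v * vecQuat v = -1 := by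
  rw [vecQuat_mul, hv, cross_self]
  ext <;> simp

theorem vecQuat_anticomm {v w : Fin 3 → ℝ} (h : v ⬝ᵥ w = 0) :
    vecQuat v * vecQuat w = -(vecQuat w * vecQuat v) := by
  rw [vecQuat_mul, vecQuat_mul, dotProduct_comm w, h, ← cross_anticomm]
  ext <;> simp [-cross_anticomm]

/-- The rotation `v ↦ g̅ v g` of `ℝ³` (for a unit quaternion `g`). -/
noncomputable def quatRot (g : ℍ[ℝ]) (v : Fin 3 → ℝ) : Fin 3 → ℝ :=
  ![(star g * vecQuat v * g).imI, (star g * vecQuat v * g).imJ, (star g * vecQuat v * g).imK]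

theorem vecQuat_quatRot (g : ℍ[ℝ]) (v : Fin 3 → ℝ) :
    vecQuat (quatRot g v) = star g * vecQuat v * g := by
  ext <;> simp [quatRot]
  ring

/-- The left factor acts first. Hence left multiplication by `Q₈` changes signs in the standard
frame before `g` rotates it, and right multiplication commutes with the `Q₈`-action. -/
theorem quatRot_mul (g h : ℍ[ℝ]) (v : Fin 3 → ℝ) :
    quatRot (g * h) v = quatRot h (quatRot g v) := by
  apply vecQuat_injective
  simp only [vecQuat_quatRot, star_mul, mul_assoc]

theorem quatRot_add (g : ℍ[ℝ]) (v w : Fin 3 → ℝ) :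
    quatRot g (v + w) = quatRot g v + quatRot g w := by
  apply vecQuat_injective
  simp only [vecQuat_quatRot, vecQuat_add, mul_add, add_mul]

theorem quatRot_smul (g : ℍ[ℝ]) (c : ℝ) (v : Fin 3 → ℝ) :
    quatRot g (c • v) = c • quatRot g v := by
  apply vecQuat_injective
  simp only [vecQuat_quatRot, vecQuat_smul, mul_smul_comm, smul_mul_assoc]

theorem quatRot_one (v : Fin 3 → ℝ) : quatRot 1 v = v := by
  apply vecQuat_injective
  simp [vecQuat_quatRot]

theorem continuous_quatRot {Y : Type*} [TopologicalSpace Y] {f : Y → ℍ[ℝ]} {v : Y → Fin 3 → ℝ}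
    (hf : Continuous f) (hcv : Continuous v) : Continuous fun y => quatRot (f y) (v y) := by
  have hv : Continuous vecQuat := by
    have : vecQuat = fun v : Fin 3 → ℝ => (v 0) • vecQuat ![1, 0, 0] +
        (v 1) • vecQuat ![0, 1, 0] + (v 2) • vecQuat ![0, 0, 1] := by
      funext v
      ext <;> simp
    rw [this]
    fun_prop
  have h : Continuous fun y => star (f y) * vecQuat (v y) * f y :=
    (hf.star.mul (hv.comp hcv)).mul hf
  refine continuous_pi fun i => ?_
  fin_cases i
  · exact Quaternion.continuous_imI.comp h
  · exact Quaternion.continuous_imJ.comp h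
  · exact Quaternion.continuous_imK.comp h

/-- The group `S³` of unit quaternions. -/
abbrev UnitQuat : Type := Metric.sphere (0 : ℍ[ℝ]) 1

noncomputable instance : Group UnitQuat := Metric.unitSphere.instGroup

noncomputable instance : HasDistribNeg UnitQuat := Metric.sphere.instHasDistribNeg

theorem UnitQuat.star_mul_self (g : UnitQuat) : star (g : ℍ[ℝ]) * (g : ℍ[ℝ]) = 1 := by
  have h : ‖(g : ℍ[ℝ])‖ = 1 := by simp
  rw [Quaternion.star_mul_self, Quaternion.normSq_eq_norm_mul_self, h]
  simp

theorem UnitQuat.self_mul_star (g : UnitQuat) : (g : ℍ[ℝ]) * star (g : ℍ[ℝ]) = 1 := by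
  have h : ‖(g : ℍ[ℝ])‖ = 1 := by simp
  rw [Quaternion.self_mul_star, Quaternion.normSq_eq_norm_mul_self, h]
  simp

theorem mem_unitQuat {g : ℍ[ℝ]} (hg : Quaternion.normSq g = 1) :
    g ∈ Metric.sphere (0 : ℍ[ℝ]) 1 := by
  rw [Quaternion.normSq_eq_norm_mul_self] at hg
  rw [mem_sphere_zero_iff_norm]
  nlinarith [norm_nonneg g]

instance : SimplyConnectedSpace UnitQuat :=
  simplyConnectedSpace_sphere (by rw [Quaternion.finrank_eq_four]; norm_num)

theorem quatRot_eq_iff (g : UnitQuat) (v w : Fin 3 → ℝ) :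
    quatRot g v = w ↔ vecQuat v * g = g * vecQuat w := by
  rw [← vecQuat_injective.eq_iff, vecQuat_quatRot]
  constructor
  · intro h
    rw [← h, ← mul_assoc, ← mul_assoc, g.self_mul_star, one_mul]
  · intro h
    rw [mul_assoc, h, ← mul_assoc, g.star_mul_self, one_mul]

/-- Conjugation by a unit quaternion is multiplicative and fixes scalars; the real and imaginary
parts of a product of pure quaternions are minus the dot product and the cross product. -/
theorem dot_and_cross_quatRot (g : UnitQuat) (v w : Fin 3 → ℝ) :
    quatRot g v ⬝ᵥ quatRot g w = v ⬝ᵥ w ∧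
      crossProduct (quatRot g v) (quatRot g w) = quatRot g (crossProduct v w) := by
  have h : vecQuat (quatRot g v) * vecQuat (quatRot g w)
      = star (g : ℍ[ℝ]) * (vecQuat v * vecQuat w) * g := by
    rw [vecQuat_quatRot, vecQuat_quatRot]
    calc _ = star (g : ℍ[ℝ]) * vecQuat v * ((g : ℍ[ℝ]) * star (g : ℍ[ℝ])) * vecQuat w * g := by
          simp only [mul_assoc]
      _ = _ := by rw [g.self_mul_star, mul_one]; simp only [mul_assoc]
  have hc : ∀ c : ℝ, star (g : ℍ[ℝ]) * (-(c : ℍ[ℝ])) * g = -(c : ℍ[ℝ]) := by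
    intro c
    rw [mul_neg, neg_mul, ← (Quaternion.coe_commutes c (star (g : ℍ[ℝ]))), mul_assoc,
      g.star_mul_self, mul_one]
  rw [vecQuat_mul, vecQuat_mul, mul_add, add_mul, ← vecQuat_quatRot, hc] at h
  constructor
  · have := congrArg (fun q : ℍ[ℝ] => q.re) h
    simpa using this
  · apply vecQuat_injective
    have h1 := congrArg (fun q : ℍ[ℝ] => q.imI) h
    have h2 := congrArg (fun q : ℍ[ℝ] => q.imJ) h
    have h3 := congrArg (fun q : ℍ[ℝ] => q.imK) h
    simp at h1 h2 h3
    ext <;> simp [h1, h2, h3]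

/-- Normalise `1 - ab`: both `a(1 - ab)` and `(1 - ab)b` equal `a + b`. It vanishes only if `a =
-b`. The commutation clause serves to fix one vector while moving another. -/
theorem exists_unitQuat_intertwining {a b : ℍ[ℝ]} (ha : a * a = -1) (hb : b * b = -1)
    (hab : a ≠ -b) :
    ∃ g : UnitQuat, a * g = g * b ∧ ∀ c, Commute c (a * b) → Commute c (g : ℍ[ℝ]) := by
  have hx : 1 - a * b ≠ 0 := by
    intro h
    have h1 : a * (a * b) = a := by rw [← sub_eq_zero.1 h, mul_one]
    rw [← mul_assoc, ha, neg_one_mul] at h1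
    exact hab h1.symm
  refine ⟨⟨‖1 - a * b‖⁻¹ • (1 - a * b), by simp [norm_smul, hx]⟩, ?_, fun c hc => ?_⟩
  · simp only [mul_smul_comm, smul_mul_assoc, mul_sub, sub_mul, mul_one, one_mul]
    rw [← mul_assoc, ha, mul_assoc, hb]
    simp [add_comm]
  · exact Commute.smul_right ((Commute.one_right c).sub_right hc) _

/-- The first vector of the standard basis of `ℝ³`. -/
def stdFst : Fin 3 → ℝ := ![1, 0, 0]

/-- The second vector of the standard basis of `ℝ³`. -/
def stdSnd : Fin 3 → ℝ := ![0, 1, 0]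

theorem stdFrame_mem : (stdFst, stdSnd) ∈ frameSet := by simp [frameSet, stdFst, stdSnd]

theorem exists_quatRot_fst_eq {w : Fin 3 → ℝ} (hw : w ⬝ᵥ w = 1) :
    ∃ g : UnitQuat, quatRot g stdFst = w := by
  by_cases h : vecQuat stdFst = -vecQuat w
  -- Antipodal case: a half turn about an orthogonal axis.
  · refine ⟨⟨vecQuat stdSnd, mem_unitQuat ?_⟩, ?_⟩
    · simp [Quaternion.normSq_def', stdSnd]
    · have hw' : w = -stdFst := by
        apply vecQuat_injective
        rw [← neg_one_smul ℝ, vecQuat_smul, h]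
        simp
      rw [hw']
      ext i
      fin_cases i <;> simp [quatRot, stdFst, stdSnd]
  · obtain ⟨g, hg, -⟩ := exists_unitQuat_intertwining (vecQuat_mul_self stdFrame_mem.1)
      (vecQuat_mul_self hw) h
    exact ⟨g, (quatRot_eq_iff _ _ _).2 hg⟩

/-- The frame obtained by rotating the standard frame with a unit quaternion. -/
noncomputable def quatFrame (g : UnitQuat) : frameSet :=
  ⟨(quatRot g stdFst, quatRot g stdSnd), by
    simp only [frameSet, Set.mem_ofPred_eq, (dot_and_cross_quatRot g _ _).1]
    exact stdFrame_mem⟩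

theorem quatFrame_surjective : Function.Surjective quatFrame := by
  rintro ⟨⟨n, m⟩, hn, hm, hnm⟩
  simp only at hn hm hnm
  obtain ⟨g, hg⟩ := exists_quatRot_fst_eq hn
  suffices ∃ h : UnitQuat, quatRot h n = n ∧ quatRot h (quatRot g stdSnd) = m by
    obtain ⟨h, h1, h2⟩ := this
    refine ⟨g * h, Subtype.ext (Prod.ext ?_ ?_)⟩
    · simp [quatFrame, quatRot_mul, hg, h1]
    · simp [quatFrame, quatRot_mul, h2]
  obtain ⟨-, hm', hnm'⟩ := (quatFrame g).2
  simp only [quatFrame] at hm' hnm'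
  rw [hg] at hnm'
  set m' := quatRot g stdSnd
  -- Both `m'` and `m` are orthogonal to `n`. If they are opposite, the half turn about `n` works;
  -- otherwise `n` anticommutes with each, hence commutes with their product and is fixed by the
  -- intertwiner.
  by_cases h : vecQuat m' = -vecQuat m
  · refine ⟨⟨vecQuat n, mem_unitQuat ?_⟩, ?_, ?_⟩
    · simp only [Quaternion.normSq_def', vecQuat_re, vecQuat_imI, vecQuat_imJ, vecQuat_imK]
      simp only [dotProduct, Fin.sum_univ_three] at hn
      linarith
    · exact (quatRot_eq_iff _ _ _).2 rfl
    · rw [quatRot_eq_iff, h, vecQuat_anticomm hnm, neg_mul]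
  · obtain ⟨k, hk, hc⟩ := exists_unitQuat_intertwining (vecQuat_mul_self hm')
      (vecQuat_mul_self hm) h
    refine ⟨k, (quatRot_eq_iff _ _ _).2 (hc _ ?_), (quatRot_eq_iff _ _ _).2 hk⟩
    rw [commute_iff_eq, ← mul_assoc, vecQuat_anticomm hnm', neg_mul, mul_assoc,
      vecQuat_anticomm hnm, mul_neg, neg_neg, mul_assoc]

theorem eq_one_or_eq_neg_one_of_commute {k : UnitQuat} (hi : Commute (vecQuat stdFst) (k : ℍ[ℝ]))
    (hj : Commute (vecQuat stdSnd) (k : ℍ[ℝ])) : k = 1 ∨ k = -1 := by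
  have h1 := congrArg (fun q : ℍ[ℝ] => q.imJ) hi
  have h2 := congrArg (fun q : ℍ[ℝ] => q.imK) hi
  have h3 := congrArg (fun q : ℍ[ℝ] => q.imK) hj
  simp [stdFst, stdSnd] at h1 h2 h3
  have hK : (k : ℍ[ℝ]).imK = 0 := by linarith
  have hJ : (k : ℍ[ℝ]).imJ = 0 := by linarith
  have hI : (k : ℍ[ℝ]).imI = 0 := by linarith
  have hn := congrArg (fun q : ℍ[ℝ] => q.re) k.self_mul_star
  simp [hI, hJ, hK] at hn
  rcases mul_self_eq_one_iff.1 hn with h | h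
  · exact Or.inl (Subtype.ext (by ext <;> simp [h, hI, hJ, hK]))
  · exact Or.inr (Subtype.ext (by ext <;> simp [h, hI, hJ, hK]))

theorem eq_or_eq_neg_of_quatFrame_eq {g h : UnitQuat} (hgh : quatFrame g = quatFrame h) :
    g = h ∨ g = -h := by
  have key : ∀ v, quatRot g v = quatRot h v →
      Commute (vecQuat v) (((g * h⁻¹ : UnitQuat)) : ℍ[ℝ]) := by
    intro v hv
    have h1 : quatRot (g * h⁻¹ : UnitQuat) v = v := by
      rw [Metric.unitSphere.coe_mul, quatRot_mul, hv, ← quatRot_mul, ← Metric.unitSphere.coe_mul]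
      simp [quatRot_one]
    exact (quatRot_eq_iff _ _ _).1 h1
  have hgh' := Prod.ext_iff.1 (Subtype.ext_iff.1 hgh)
  rcases eq_one_or_eq_neg_one_of_commute (key _ hgh'.1) (key _ hgh'.2) with h1 | h1
  · exact Or.inl (mul_inv_eq_one.1 h1)
  · refine Or.inr ?_
    rw [mul_inv_eq_iff_eq_mul] at h1
    simpa using h1

end QuaternionFrames

/-! ### The action of `Q₈` on `S³` and the covering `S³ → 𝒩` -/

section QuaternionGroupLift

variable {G : Type*} [Group G] {x y : G}

theorem pow_val_add (hx : x ^ 4 = 1) (i j : ZMod (2 * 2)) :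
    x ^ (i + j).val = x ^ i.val * x ^ j.val := by
  rw [← pow_add, ZMod.val_add]
  exact (pow_eq_pow_mod _ hx).symm

theorem pow_val_neg (hx : x ^ 4 = 1) (i : ZMod (2 * 2)) : x ^ (-i).val = (x ^ i.val)⁻¹ := by
  rw [eq_inv_iff_mul_eq_one, ← pow_val_add hx, neg_add_cancel, ZMod.val_zero, pow_zero]

/-- The homomorphism from `Q₈` given by images `x`, `y` of the generators `i`, `j`. -/
def Q8.lift (hx : x ^ 4 = 1) (hy : y * y = x * x) (hxy : x * y * x = y) : Q8 →* G where
  toFun q := match q with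
    | .a i => x ^ i.val
    | .xa i => y * x ^ i.val
  map_one' := by
    change x ^ (0 : ZMod (2 * 2)).val = 1
    rw [ZMod.val_zero, pow_zero]
  map_mul' p q := by
    have hsemi : SemiconjBy y x⁻¹ x := by
      rw [SemiconjBy, mul_inv_eq_iff_eq_mul]
      exact hxy.symm
    have hcomm : ∀ i : ZMod (2 * 2), x ^ i.val * y = y * (x ^ i.val)⁻¹ := fun i => by
      rw [← inv_pow]
      exact (hsemi.pow_right i.val).eq.symm
    have h2 : x ^ ((2 : ℕ) : ZMod (2 * 2)).val = y * y := by
      rw [show ((2 : ℕ) : ZMod (2 * 2)).val = 2 from rfl, hy, pow_two]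
    rcases p with i | i <;> rcases q with j | j
    · exact pow_val_add hx i j
    · change y * x ^ (j - i).val = x ^ i.val * (y * x ^ j.val)
      rw [sub_eq_neg_add, pow_val_add hx, pow_val_neg hx, ← mul_assoc, ← mul_assoc, hcomm]
    · change y * x ^ (i + j).val = y * x ^ i.val * x ^ j.val
      rw [pow_val_add hx, mul_assoc]
    · change x ^ (((2 : ℕ) : ZMod (2 * 2)) + j - i).val = y * x ^ i.val * (y * x ^ j.val)
      rw [sub_eq_add_neg, add_right_comm, pow_val_add hx, pow_val_add hx, pow_val_neg hx, h2,
        mul_assoc y (x ^ i.val), ← mul_assoc (x ^ i.val), hcomm]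
      simp only [mul_assoc]

/-- Every element other than `±1` squares to `-1`, so a nontrivial kernel would contain `-1`. -/
theorem Q8.hom_injective {f : Q8 →* G} (hf : f Q8.negOne ≠ 1) : Function.Injective f := by
  rw [injective_iff_map_eq_one]
  intro q hq
  have h : ∀ q : Q8, q = 1 ∨ q = Q8.negOne ∨ q * q = Q8.negOne := by decide
  rcases h q with h | h | h
  · exact h
  · exact absurd (h ▸ hq) hf
  · exact absurd (by rw [← h, map_mul, hq, one_mul]) hf

theorem Q8.hom_ext {f f' : Q8 →* G} (hi : f Q8.i = f' Q8.i) (hj : f Q8.j = f' Q8.j) :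
    f = f' := by
  have h : ∀ q : Q8, ∃ m n : Fin 4, q = Q8.i ^ (m : ℕ) * Q8.j ^ (n : ℕ) := by decide
  ext q
  obtain ⟨m, n, rfl⟩ := h q
  simp [hi, hj]

end QuaternionGroupLift

section Coverings

open Quaternion Topology unitInterval

theorem quatRot_units_smul (g : ℍ[ℝ]) (u : ℤˣ) (v : Fin 3 → ℝ) :
    quatRot g (u • v) = u • quatRot g v := by
  rcases Int.units_eq_one_or u with rfl | rfl
  · simp
  · rw [Units.neg_smul, Units.neg_smul, one_smul, one_smul, ← neg_one_smul ℝ v, quatRot_smul,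
      neg_one_smul]

/-- The image of `i ∈ Q₈` in `S³`. -/
noncomputable def unitI : UnitQuat :=
  -- The minus sign is forced by the orientation of `A`: under `v ↦ g̅ v g`, the turn of `m` towards
  -- `n × m` lifts to `cos - sin · stdFst`.
  ⟨-vecQuat stdFst, mem_unitQuat (by simp [Quaternion.normSq_def', stdFst])⟩

/-- The image of `j ∈ Q₈` in `S³`. -/
noncomputable def unitJ : UnitQuat :=
  ⟨vecQuat stdSnd, mem_unitQuat (by simp [Quaternion.normSq_def', stdSnd])⟩

theorem unitI_mul_self : unitI * unitI = -1 := by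
  ext1
  exact (neg_mul_neg _ _).trans (vecQuat_mul_self stdFrame_mem.1)

theorem unitJ_mul_self : unitJ * unitJ = -1 := by
  ext1
  exact vecQuat_mul_self stdFrame_mem.2.1

theorem unitI_mul_unitJ_mul_unitI : unitI * unitJ * unitI = unitJ := by
  ext1
  change -vecQuat stdFst * vecQuat stdSnd * -vecQuat stdFst = vecQuat stdSnd
  rw [neg_mul, neg_mul_neg, vecQuat_anticomm stdFrame_mem.2.2, neg_mul, mul_assoc,
    vecQuat_mul_self stdFrame_mem.1]
  simp

/-- The embedding of `Q₈` into the group of unit quaternions. -/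
noncomputable def Q8.toUnitQuat : Q8 →* UnitQuat :=
  Q8.lift (x := unitI) (y := unitJ)
    (by rw [show (4 : ℕ) = 2 * 2 from rfl, pow_mul, pow_two unitI, unitI_mul_self]; simp)
    (by rw [unitI_mul_self, unitJ_mul_self]) unitI_mul_unitJ_mul_unitI

theorem Q8.toUnitQuat_i : Q8.toUnitQuat Q8.i = unitI := pow_one _

theorem Q8.toUnitQuat_j : Q8.toUnitQuat Q8.j = unitJ := mul_one _

theorem Q8.toUnitQuat_negOne : Q8.toUnitQuat Q8.negOne = -1 := by
  rw [← Q8.relations.1, map_mul, Q8.toUnitQuat_i, unitI_mul_self]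

theorem Q8.toUnitQuat_injective : Function.Injective Q8.toUnitQuat := by
  refine Q8.hom_injective ?_
  rw [Q8.toUnitQuat_negOne]
  intro h
  have := congrArg (fun q : UnitQuat => (q : ℍ[ℝ]).re) h
  norm_num at this

/-- `Q₈` acts on `S³` by left multiplication. -/
noncomputable instance : MulAction Q8 UnitQuat := MulAction.compHom UnitQuat Q8.toUnitQuat

theorem Q8.smul_unitQuat (q : Q8) (g : UnitQuat) : q • g = Q8.toUnitQuat q * g := rfl

instance : ContinuousConstSMul Q8 UnitQuat := ⟨fun _ => continuous_const.mul continuous_id⟩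

instance : IsCancelSMul Q8 UnitQuat where
  right_cancel' _ _ _ h := Q8.toUnitQuat_injective (mul_right_cancel h)

/-- The character of `Q₈` by which it acts on the first vector of the standard frame. -/
def Q8.fstSign : Q8 →* ℤˣ :=
  Q8.lift (x := 1) (y := -1) (by simp) (by simp) (by simp)

/-- The character of `Q₈` by which it acts on the second vector of the standard frame. -/
def Q8.sndSign : Q8 →* ℤˣ :=
  Q8.lift (x := -1) (y := 1) (by decide) (by simp) (by simp)

/-- `i` is a half turn about the first axis and `j` about the second; the general case follows by
multiplicativity, since `i` and `j` generate. -/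
theorem quatRot_toUnitQuat (q : Q8) :
    quatRot (Q8.toUnitQuat q) stdFst = Q8.fstSign q • stdFst ∧
      quatRot (Q8.toUnitQuat q) stdSnd = Q8.sndSign q • stdSnd := by
  have hmul : ∀ (v : Fin 3 → ℝ) (χ : Q8 →* ℤˣ) (p q : Q8),
      quatRot (Q8.toUnitQuat p) v = χ p • v → quatRot (Q8.toUnitQuat q) v = χ q • v →
      quatRot (Q8.toUnitQuat (p * q)) v = χ (p * q) • v := by
    intro v χ p q hp hq
    rw [map_mul, map_mul, Metric.unitSphere.coe_mul, quatRot_mul, hp, quatRot_units_smul, hq,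
      mul_smul]
  have h : ∀ q : Q8, ∃ m n : Fin 4, q = Q8.i ^ (m : ℕ) * Q8.j ^ (n : ℕ) := by decide
  have hpow : ∀ (v : Fin 3 → ℝ) (χ : Q8 →* ℤˣ) (p : Q8) (n : ℕ),
      quatRot (Q8.toUnitQuat p) v = χ p • v →
      quatRot (Q8.toUnitQuat (p ^ n)) v = χ (p ^ n) • v := by
    intro v χ p n hp
    induction n with
    | zero => simp [quatRot_one]
    | succ n ih => rw [pow_succ]; exact hmul v χ _ _ ih hp
  have hi1 : Q8.fstSign Q8.i = 1 := by decide
  have hj1 : Q8.fstSign Q8.j = -1 := by decide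
  have hi2 : Q8.sndSign Q8.i = -1 := by decide
  have hj2 : Q8.sndSign Q8.j = 1 := by decide
  have hr : ∀ a b : Fin 3 → ℝ, a ⬝ᵥ b = 0 → vecQuat a * vecQuat b = vecQuat b * vecQuat (-a) := by
    intro a b hab
    rw [vecQuat_anticomm hab, ← neg_one_smul ℝ a, vecQuat_smul]
    simp
  obtain ⟨m, n, rfl⟩ := h q
  refine ⟨hmul _ _ _ _ (hpow _ _ _ _ ?_) (hpow _ _ _ _ ?_),
    hmul _ _ _ _ (hpow _ _ _ _ ?_) (hpow _ _ _ _ ?_)⟩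
  · rw [hi1, one_smul, quatRot_eq_iff, Q8.toUnitQuat_i]
    simp [unitI]
  · rw [hj1, Units.neg_smul, one_smul, quatRot_eq_iff, Q8.toUnitQuat_j]
    exact hr _ _ stdFrame_mem.2.2
  · rw [hi2, Units.neg_smul, one_smul, quatRot_eq_iff, Q8.toUnitQuat_i]
    have := hr stdSnd stdFst ((dotProduct_comm _ _).trans stdFrame_mem.2.2)
    simpa [unitI] using this
  · rw [hj2, one_smul, quatRot_eq_iff, Q8.toUnitQuat_j]
    rfl

theorem quatFrame_smul (q : Q8) (g : UnitQuat) :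
    (quatFrame (q • g)).1 =
      (Q8.fstSign q • (quatFrame g).1.1, Q8.sndSign q • (quatFrame g).1.2) := by
  simp only [quatFrame, Q8.smul_unitQuat, Metric.unitSphere.coe_mul, quatRot_mul,
    quatRot_toUnitQuat, quatRot_units_smul]

theorem vecMulVec_units_smul (u : ℤˣ) (v : Fin 3 → ℝ) :
    Matrix.vecMulVec (u • v) (u • v) = Matrix.vecMulVec v v := by
  rcases Int.units_eq_one_or u with rfl | rfl
  · simp
  · simp [Units.neg_smul, Matrix.vecMulVec_neg, Matrix.neg_vecMulVec]

/-- Applying both matrices to `v` gives `v = (w · v) w`; pairing with `v` gives `(w · v)² = 1`. -/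
theorem eq_units_smul_of_vecMulVec_eq {v w : Fin 3 → ℝ} (hv : v ⬝ᵥ v = 1)
    (h : Matrix.vecMulVec v v = Matrix.vecMulVec w w) : ∃ u : ℤˣ, v = u • w := by
  have h1 : ∀ i, v i = w i * (w ⬝ᵥ v) := by
    intro i
    have h2 := congrFun (congrArg (fun M : Matrix (Fin 3) (Fin 3) ℝ => M *ᵥ v) h) i
    simp only [Matrix.vecMulVec_mulVec, hv] at h2
    simpa using h2
  have h3 : (w ⬝ᵥ v) * (w ⬝ᵥ v) = 1 := by
    calc _ = (fun i => w i * (w ⬝ᵥ v)) ⬝ᵥ v := by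
          simp only [dotProduct, Fin.sum_univ_three]
          ring
      _ = 1 := by rw [← funext h1, hv]
  rcases mul_self_eq_one_iff.1 h3 with h4 | h4
  · exact ⟨1, funext fun i => by rw [h1 i, h4]; simp⟩
  · exact ⟨-1, funext fun i => by rw [h1 i, h4]; simp [Units.neg_smul]⟩

/-- The covering map `S³ → 𝒩`. -/
noncomputable def quatCover (r : ℝ) (g : UnitQuat) : calN r := framePoint r (quatFrame g)

theorem quatCover_smul (r : ℝ) (q : Q8) (g : UnitQuat) : quatCover r (q • g) = quatCover r g := by
  apply Subtype.ext
  simp only [quatCover, framePoint, frameMatrix, quatFrame_smul, vecMulVec_units_smul]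

theorem continuous_quatCover (r : ℝ) : Continuous (quatCover r) := by
  have h : ∀ v : Fin 3 → ℝ, Continuous fun g : UnitQuat => quatRot g v := fun v =>
    continuous_quatRot continuous_subtype_val continuous_const
  have h1 := h stdFst
  have h2 := h stdSnd
  refine Continuous.subtype_mk ?_ _
  simp only [frameMatrix, quatFrame]
  exact Continuous.const_smul
    (Continuous.sub (h1.matrix_vecMulVec h1) (h2.matrix_vecMulVec h2)) r

theorem quatCover_surjective (r : ℝ) : Function.Surjective (quatCover r) := by
  rintro ⟨Q, p, hp, rfl⟩
  obtain ⟨g, hg⟩ := quatFrame_surjective ⟨p, hp⟩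
  exact ⟨g, Subtype.ext (by simp [quatCover, framePoint, hg])⟩

theorem quatCover_eq_iff {r : ℝ} (hr : r ≠ 0) {g h : UnitQuat} :
    quatCover r g = quatCover r h ↔ g ∈ MulAction.orbit Q8 h := by
  constructor
  · intro hgh
    have hinj : Function.Injective fun M : Matrix (Fin 3) (Fin 3) ℝ => r • M :=
      smul_right_injective _ hr
    have h1 := congrArg (fun Q => (rho1 r Q : Matrix (Fin 3) (Fin 3) ℝ)) hgh
    have h2 := congrArg (fun Q => (rho2 r Q : Matrix (Fin 3) (Fin 3) ℝ)) hgh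
    simp only [quatCover, rho1_framePoint, rho2_framePoint] at h1 h2
    obtain ⟨u, hu⟩ := eq_units_smul_of_vecMulVec_eq (quatFrame g).2.1 (hinj h1)
    obtain ⟨w, hw⟩ := eq_units_smul_of_vecMulVec_eq (quatFrame g).2.2.1 (hinj h2)
    have hsign : ∀ u w : ℤˣ, ∃ q : Q8, Q8.fstSign q = u ∧ Q8.sndSign q = w := by decide
    obtain ⟨q, rfl, rfl⟩ := hsign u w
    have hq : quatFrame g = quatFrame (q • h) := by
      apply Subtype.ext
      rw [quatFrame_smul]
      exact Prod.ext hu hw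
    -- The sign still undetermined by the frame is absorbed by `-1 ∈ Q₈`.
    rcases eq_or_eq_neg_of_quatFrame_eq hq with rfl | rfl
    · exact ⟨q, rfl⟩
    · refine ⟨Q8.negOne * q, ?_⟩
      simp only [mul_smul]
      rw [Q8.smul_unitQuat Q8.negOne, Q8.toUnitQuat_negOne, neg_one_mul]
  · rintro ⟨q, rfl⟩
    exact quatCover_smul r q h

theorem isQuotientCoveringMap_quatCover {r : ℝ} (hr : r ≠ 0) :
    IsQuotientCoveringMap (quatCover r) Q8 := by
  have hc := continuous_quatCover r
  have hq : IsQuotientMap (quatCover r) :=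
    hc.isClosedMap.isQuotientMap hc (quatCover_surjective r)
  exact hq.isQuotientCoveringMap_of_properlyDiscontinuousSMul (quatCover_eq_iff hr)

/-! ### The covering `S² → 𝒫` -/

/-- The unit vectors of `ℝ³`. -/
abbrev UnitVec : Type := {v : Fin 3 → ℝ // v ⬝ᵥ v = 1}

/-- `UnitVec` is the Euclidean unit sphere. -/
noncomputable def unitVecHomeomorph :
    Metric.sphere (0 : EuclideanSpace ℝ (Fin 3)) 1 ≃ₜ UnitVec :=
  (PiLp.homeomorph 2 fun _ : Fin 3 => ℝ).subtype fun x => by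
    rw [mem_sphere_zero_iff_norm, ← sq_eq_sq₀ (norm_nonneg _) zero_le_one,
      EuclideanSpace.real_norm_sq_eq]
    simp [dotProduct, pow_two, PiLp.homeomorph]

instance : CompactSpace UnitVec := unitVecHomeomorph.compactSpace

instance : SimplyConnectedSpace UnitVec :=
  have : SimplyConnectedSpace (Metric.sphere (0 : EuclideanSpace ℝ (Fin 3)) 1) :=
    simplyConnectedSpace_sphere (by simp)
  unitVecHomeomorph.symm.toHomotopyEquiv.simplyConnectedSpace

theorem units_smul_dotProduct_self (u : ℤˣ) (v : Fin 3 → ℝ) : (u • v) ⬝ᵥ (u • v) = v ⬝ᵥ v := by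
  rcases Int.units_eq_one_or u with rfl | rfl
  · simp
  · simp [Units.neg_smul]

/-- `{±1}` acts on the sphere. -/
instance : MulAction ℤˣ UnitVec where
  smul u v := ⟨u • v.1, by rw [units_smul_dotProduct_self, v.2]⟩
  one_smul v := Subtype.ext (one_smul _ _)
  mul_smul u w v := Subtype.ext (mul_smul _ _ _)

theorem UnitVec.coe_units_smul (u : ℤˣ) (v : UnitVec) : (u • v).1 = u • v.1 := rfl

instance : ContinuousConstSMul ℤˣ UnitVec :=
  ⟨fun u => Continuous.subtype_mk (continuous_subtype_val.const_smul u) _⟩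

instance : IsCancelSMul ℤˣ UnitVec where
  right_cancel' u w v h := by
    have hv : v.1 ≠ 0 := by
      intro h0
      have := v.2
      simp [h0] at this
    have h' : u • v.1 = w • v.1 := congrArg Subtype.val h
    rcases Int.units_eq_one_or u with rfl | rfl <;> rcases Int.units_eq_one_or w with rfl | rfl
    · rfl
    · rw [Units.neg_smul, one_smul, self_eq_neg] at h'
      exact absurd h' hv
    · rw [Units.neg_smul, one_smul, neg_eq_self] at h'
      exact absurd h' hv
    · rfl

/-- The covering map `S² → 𝒫`. -/
def vecCover (r : ℝ) (v : UnitVec) : calP r := ⟨r • Matrix.vecMulVec v.1 v.1, v.1, v.2, rfl⟩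

theorem isQuotientCoveringMap_vecCover {r : ℝ} (hr : r ≠ 0) :
    IsQuotientCoveringMap (vecCover r) ℤˣ := by
  have hv : Continuous fun v : UnitVec => v.1 := continuous_subtype_val
  have hc : Continuous (vecCover r) :=
    Continuous.subtype_mk ((hv.matrix_vecMulVec hv).const_smul r) _
  have hs : Function.Surjective (vecCover r) := by
    rintro ⟨Q, n, hn, rfl⟩
    exact ⟨⟨n, hn⟩, rfl⟩
  have hq : IsQuotientMap (vecCover r) := hc.isClosedMap.isQuotientMap hc hs
  have := unitVecHomeomorph.symm.isClosedEmbedding.locallyCompactSpace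
  refine hq.isQuotientCoveringMap_of_properlyDiscontinuousSMul fun {v w} => ⟨fun h => ?_, ?_⟩
  · have h1 : r • Matrix.vecMulVec v.1 v.1 = r • Matrix.vecMulVec w.1 w.1 := congrArg Subtype.val h
    obtain ⟨u, hu⟩ := eq_units_smul_of_vecMulVec_eq v.2 (smul_right_injective _ hr h1)
    exact ⟨u, Subtype.ext hu.symm⟩
  · rintro ⟨u, rfl⟩
    apply Subtype.ext
    simp only [vecCover, UnitVec.coe_units_smul, vecMulVec_units_smul]

/-! ### Equivariant isotopies -/

/-- Right multiplication along a path from `1` to `e⁻¹ e'` commutes with the left action of `Q₈`. -/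
theorem exists_equivariant_isotopy_unitQuat (e e' : UnitQuat) :
    ∃ Ψ : C(I × UnitQuat, UnitQuat), (∀ x, Ψ (0, x) = x) ∧ Ψ (1, e) = e' ∧
      ∀ (s : I) (q : Q8) (x : UnitQuat), Ψ (s, q • x) = q • Ψ (s, x) := by
  let c : Path (1 : UnitQuat) (e⁻¹ * e') := PathConnectedSpace.somePath _ _
  refine ⟨⟨fun p => p.2 * c p.1, continuous_snd.mul (c.continuous.comp continuous_fst)⟩,
    fun x => ?_, ?_, fun s q x => ?_⟩
  · simp
  · simp
  · simp [Q8.smul_unitQuat, mul_assoc]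

/-- Rotations along a path in `S³` are linear, so they commute with `±1`. -/
theorem exists_equivariant_isotopy_unitVec (e e' : UnitVec) :
    ∃ Ψ : C(I × UnitVec, UnitVec), (∀ x, Ψ (0, x) = x) ∧ Ψ (1, e) = e' ∧
      ∀ (s : I) (u : ℤˣ) (x : UnitVec), Ψ (s, u • x) = u • Ψ (s, x) := by
  obtain ⟨g, hg⟩ := exists_quatRot_fst_eq e.2
  obtain ⟨g', hg'⟩ := exists_quatRot_fst_eq e'.2
  let c : Path (1 : UnitQuat) (g⁻¹ * g') := PathConnectedSpace.somePath _ _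
  have hc : Continuous fun p : I × UnitVec => quatRot (c p.1) p.2.1 :=
    continuous_quatRot (continuous_subtype_val.comp (c.continuous.comp continuous_fst))
      (continuous_subtype_val.comp continuous_snd)
  have hunit : ∀ p : I × UnitVec, quatRot (c p.1) p.2.1 ⬝ᵥ quatRot (c p.1) p.2.1 = 1 := fun p => by
    rw [(dot_and_cross_quatRot _ _ _).1, p.2.2]
  refine ⟨⟨fun p => ⟨quatRot (c p.1) p.2.1, hunit p⟩, hc.subtype_mk hunit⟩,
    fun x => ?_, ?_, fun s u x => ?_⟩
  · exact Subtype.ext (by simp [quatRot_one])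
  · refine Subtype.ext ?_
    simp only [ContinuousMap.coe_mk, Path.target]
    rw [← hg, ← quatRot_mul, ← Metric.unitSphere.coe_mul, mul_inv_cancel_left, hg']
  · exact Subtype.ext (by simp [UnitVec.coe_units_smul, quatRot_units_smul])

end Coverings

/-! ### The fundamental group of `𝒩` -/

section FundamentalGroup

open unitInterval

namespace IsQuotientCoveringMap

variable {E X G : Type*} [TopologicalSpace E] [TopologicalSpace X] [Group G] [MulAction G E]
  {p : E → X} (hp : IsQuotientCoveringMap p G) [SimplyConnectedSpace E] {x : X} (e : p ⁻¹' {x})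

/-- The isomorphism from the group of a simply connected covering to the fundamental group of the
base, in the order of multiplication of `Pi1`. -/
noncomputable def pi1Equiv : G ≃* Pi1 X x :=
  (MulEquiv.opOp G).trans (MulEquiv.op (hp.fundamentalGroupEquiv e)).symm

theorem pi1Equiv_symm_smul (γ : Path x x) (F : C(I, E)) (hF : ∀ t, p (F t) = γ t)
    (hF0 : F 0 = e) : (hp.pi1Equiv e).symm (pi1Class γ) • e.1 = F 1 := by
  have h := hp.unop_fundamentalGroupToMulOpposite_smul (e := e)
    (γ := FundamentalGroup.fromPath (Path.Homotopic.Quotient.mk γ))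
  have hlift : F = hp.isCoveringMap.liftPath γ e (γ.source.trans e.2.symm) :=
    (hp.isCoveringMap.eq_liftPath_iff' _).2 ⟨funext hF, hF0⟩
  rw [hlift]
  exact h

theorem pi1Equiv_eq (γ : Path x x) (F : C(I, E)) (hF : ∀ t, p (F t) = γ t) (hF0 : F 0 = e)
    {g : G} (hF1 : F 1 = g • e.1) : hp.pi1Equiv e g = pi1Class γ := by
  have := hp.isCancelSMul
  rw [← MulEquiv.eq_symm_apply]
  refine IsCancelSMul.right_cancel _ _ e.1 ?_
  rw [hp.pi1Equiv_symm_smul e γ F hF hF0, hF1]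

theorem hasHolonomy_pi1Equiv_symm (L : C(Circle, X)) (z : Circle) (hx : L z = x) :
    HasHolonomy p L ((hp.pi1Equiv e).symm (pi1Class (loopPath L z hx))) := by
  obtain ⟨F, hF, hF0⟩ := hp.isCoveringMap.exists_path_lifts (loopPath L z hx) e
    ((loopPath L z hx).source.trans e.2.symm)
  exact hp.hasHolonomy_of_loopPath hx F (congrFun hF) hF0
    (hp.pi1Equiv_symm_smul e _ F (congrFun hF) hF0).symm

end IsQuotientCoveringMap

open Quaternion

/-! ### Explicit lifts of the loops `A` and `B` -/

theorem quatRot_sub_stdFst (c s : ℝ) :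
    quatRot ((c : ℍ[ℝ]) - s • vecQuat stdFst) stdFst = (c ^ 2 + s ^ 2) • stdFst ∧
      quatRot ((c : ℍ[ℝ]) - s • vecQuat stdFst) stdSnd
        = (c ^ 2 - s ^ 2) • stdSnd + (2 * c * s) • crossProduct stdFst stdSnd := by
  constructor <;> ext i <;> fin_cases i <;>
    simp [quatRot, stdFst, stdSnd, cross_apply] <;> ring

theorem quatRot_add_stdSnd (c s : ℝ) :
    quatRot ((c : ℍ[ℝ]) + s • vecQuat stdSnd) stdFst
        = (c ^ 2 - s ^ 2) • stdFst + (2 * c * s) • crossProduct stdFst stdSnd ∧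
      quatRot ((c : ℍ[ℝ]) + s • vecQuat stdSnd) stdSnd = (c ^ 2 + s ^ 2) • stdSnd := by
  constructor <;> ext i <;> fin_cases i <;>
    simp [quatRot, stdFst, stdSnd, cross_apply] <;> ring

/-- The lift to `S³` of the path `A` at the standard frame. -/
noncomputable def liftA : C(I, UnitQuat) where
  toFun t := ⟨(Real.cos (Real.pi * t / 2) : ℍ[ℝ]) - Real.sin (Real.pi * t / 2) • vecQuat stdFst,
    mem_unitQuat (by simp [Quaternion.normSq_def', stdFst])⟩
  continuous_toFun := by
    have hc : Continuous fun t : I => Real.cos (Real.pi * t / 2) := by fun_prop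
    have hs : Continuous fun t : I => Real.sin (Real.pi * t / 2) := by fun_prop
    exact Continuous.subtype_mk
      (Continuous.sub (Quaternion.continuous_coe.comp hc) (hs.smul continuous_const)) _

/-- The lift to `S³` of the path `B` at the standard frame. -/
noncomputable def liftB : C(I, UnitQuat) where
  toFun t := ⟨(Real.cos (Real.pi * t / 2) : ℍ[ℝ]) + Real.sin (Real.pi * t / 2) • vecQuat stdSnd,
    mem_unitQuat (by simp [Quaternion.normSq_def', stdSnd])⟩
  continuous_toFun := by
    have hc : Continuous fun t : I => Real.cos (Real.pi * t / 2) := by fun_prop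
    have hs : Continuous fun t : I => Real.sin (Real.pi * t / 2) := by fun_prop
    exact Continuous.subtype_mk
      (Continuous.add (Quaternion.continuous_coe.comp hc) (hs.smul continuous_const)) _

theorem liftA_zero : liftA 0 = 1 := Subtype.ext (by simp [liftA])

theorem liftB_zero : liftB 0 = 1 := Subtype.ext (by simp [liftB])

theorem liftA_one : liftA 1 = Q8.toUnitQuat Q8.i := by
  rw [Q8.toUnitQuat_i]
  exact Subtype.ext (by simp [liftA, unitI])

theorem liftB_one : liftB 1 = Q8.toUnitQuat Q8.j := by
  rw [Q8.toUnitQuat_j]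
  exact Subtype.ext (by simp [liftB, unitJ])

theorem quatFrame_mul (h g : UnitQuat) :
    (quatFrame (h * g)).1 = (quatRot g (quatRot h stdFst), quatRot g (quatRot h stdSnd)) := by
  simp only [quatFrame, Metric.unitSphere.coe_mul, quatRot_mul]

/-- The lift at the standard frame suffices: right multiplication by `g` transports it to the frame
of `g`, and rotations respect the cross product. The half angle in `liftA` doubles under
conjugation. -/
theorem quatCover_liftA_mul (r : ℝ) (g : UnitQuat) (t : I) :
    quatCover r (liftA t * g) = loopA r (quatFrame g) t := by
  obtain ⟨h1, h2⟩ := quatRot_sub_stdFst (Real.cos (Real.pi * t / 2)) (Real.sin (Real.pi * t / 2))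
  have ha : Real.pi * t = 2 * (Real.pi * t / 2) := by ring
  refine congrArg (framePoint r) (Subtype.ext ((quatFrame_mul _ _).trans (Prod.ext ?_ ?_)))
  · simp only [liftA, ContinuousMap.coe_mk, h1, quatFrame]
    rw [Real.cos_sq_add_sin_sq, one_smul]
  · simp only [liftA, ContinuousMap.coe_mk, h2, quatFrame]
    rw [quatRot_add, quatRot_smul, quatRot_smul, (dot_and_cross_quatRot _ _ _).2, ← Real.cos_two_mul',
      mul_right_comm, ← Real.sin_two_mul, ← ha]

theorem quatCover_liftB_mul (r : ℝ) (g : UnitQuat) (t : I) :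
    quatCover r (liftB t * g) = loopB r (quatFrame g) t := by
  obtain ⟨h1, h2⟩ := quatRot_add_stdSnd (Real.cos (Real.pi * t / 2)) (Real.sin (Real.pi * t / 2))
  have ha : Real.pi * t = 2 * (Real.pi * t / 2) := by ring
  refine congrArg (framePoint r) (Subtype.ext ((quatFrame_mul _ _).trans (Prod.ext ?_ ?_)))
  · simp only [liftB, ContinuousMap.coe_mk, h1, quatFrame]
    rw [quatRot_add, quatRot_smul, quatRot_smul, (dot_and_cross_quatRot _ _ _).2, ← Real.cos_two_mul',
      mul_right_comm, ← Real.sin_two_mul, ← ha]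
  · simp only [liftB, ContinuousMap.coe_mk, h2, quatFrame]
    rw [Real.cos_sq_add_sin_sq, one_smul]

theorem isFrameIso_pi1Equiv {r : ℝ} (hr : r ≠ 0) (g : UnitQuat) :
    IsFrameIso r (quatFrame g) ((isQuotientCoveringMap_quatCover hr).pi1Equiv ⟨g, rfl⟩) := by
  constructor
  · refine IsQuotientCoveringMap.pi1Equiv_eq _ _ _
      ⟨fun t => liftA t * g, liftA.continuous.mul continuous_const⟩
      (quatCover_liftA_mul r g) ?_ ?_
    · simp [liftA_zero]
    · simp [liftA_one, Q8.smul_unitQuat]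
  · refine IsQuotientCoveringMap.pi1Equiv_eq _ _ _
      ⟨fun t => liftB t * g, liftB.continuous.mul continuous_const⟩
      (quatCover_liftB_mul r g) ?_ ?_
    · simp [liftB_zero]
    · simp [liftB_one, Q8.smul_unitQuat]

theorem IsFrameIso.unique {r : ℝ} {p : frameSet} {φ ψ : Q8 ≃* Pi1 (calN r) (framePoint r p)}
    (hφ : IsFrameIso r p φ) (hψ : IsFrameIso r p ψ) : φ = ψ := by
  have h : φ.toMonoidHom = ψ.toMonoidHom :=
    Q8.hom_ext (hφ.1.trans hψ.1.symm) (hφ.2.trans hψ.2.symm)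
  exact MulEquiv.ext fun q => DFunLike.congr_fun h q

/-- By uniqueness, `φ` is the isomorphism of the covering for any `g` over the frame, so `φ⁻¹ [L]`
is a holonomy of `L`. -/
theorem IsFrameIso.hasHolonomy {r : ℝ} (hr : r ≠ 0) {p : frameSet}
    {φ : Q8 ≃* Pi1 (calN r) (framePoint r p)} (hφ : IsFrameIso r p φ) (L : C(Circle, calN r))
    (z : Circle) (hX : L z = framePoint r p) :
    HasHolonomy (quatCover r) L (φ.symm (pi1Class (loopPath L z hX))) := by
  obtain ⟨g, rfl⟩ := quatFrame_surjective p
  rw [hφ.unique (isFrameIso_pi1Equiv hr g)]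
  exact IsQuotientCoveringMap.hasHolonomy_pi1Equiv_symm _ _ L z hX

/-! ### Holonomy under the projections `ϱ₁` and `ϱ₂` -/

/-- The first vector of the frame of a unit quaternion. -/
noncomputable def quatFrameFst : C(UnitQuat, UnitVec) where
  toFun g := ⟨(quatFrame g).1.1, (quatFrame g).2.1⟩
  continuous_toFun :=
    (continuous_quatRot continuous_subtype_val continuous_const).subtype_mk _

/-- The second vector of the frame of a unit quaternion. -/
noncomputable def quatFrameSnd : C(UnitQuat, UnitVec) where
  toFun g := ⟨(quatFrame g).1.2, (quatFrame g).2.2.1⟩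
  continuous_toFun :=
    (continuous_quatRot continuous_subtype_val continuous_const).subtype_mk _

theorem HasHolonomy.rho1_comp {r : ℝ} {L : C(Circle, calN r)} {q : Q8}
    (h : HasHolonomy (quatCover r) L q) :
    HasHolonomy (vecCover r) ((rho1 r).comp L) (Q8.fstSign q) :=
  h.map (rho1 r) quatFrameFst Q8.fstSign
    (fun g => Subtype.ext (rho1_framePoint r (quatFrame g)).symm)
    fun q g => Subtype.ext (congrArg Prod.fst (quatFrame_smul q g))

theorem HasHolonomy.rho2_comp {r : ℝ} {L : C(Circle, calN r)} {q : Q8}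
    (h : HasHolonomy (quatCover r) L q) :
    HasHolonomy (vecCover r) ((rho2 r).comp L) (Q8.sndSign q) :=
  h.map (rho2 r) quatFrameSnd Q8.sndSign
    (fun g => Subtype.ext (rho2_framePoint r (quatFrame g)).symm)
    fun q g => Subtype.ext (congrArg Prod.snd (quatFrame_smul q g))

/-- Representatives of the five conjugacy classes of `Q₈`. -/
def Q8.classRep : Fin 5 → Q8 := ![1, Q8.i, Q8.j, Q8.k, Q8.negOne]

/-- The elements of `{±1}`. -/
def signRep : Fin 2 → ℤˣ := ![1, -1]

end FundamentalGroup

/-! ### The classification -/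

theorem corollary4p14 (r : ℝ) (hr : 0 < r) :
    -- the isomorphisms `φ_X` exist and are determined by the frame over `X`
    (∀ p : frameSet, ∃! φ : Q8 ≃* Pi1 (calN r) (framePoint r p), IsFrameIso r p φ) ∧
    ∃ (H : Fin 5 → FreeLoopClass (calN r)) (h : Fin 2 → FreeLoopClass (calP r)),
      -- `[S¹, 𝒩] = {H₀, …, H₄}` has exactly five elements, `[S¹, 𝒫] = {h₀, h₁}` exactly two
      Function.Bijective H ∧ Function.Bijective h ∧
      -- `H₀` and `h₀` are the classes of the trivial loops
      (∀ X : calN r, freeClass (ContinuousMap.const Circle X) = H 0) ∧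
      (∀ x : calP r, freeClass (ContinuousMap.const Circle x) = h 0) ∧
      -- the classes in terms of `φ_X⁻¹ [L]`, for every point `X = L z` of the loop
      (∀ (L : C(Circle, calN r)) (z : Circle) (p : frameSet) (hX : L z = framePoint r p)
          (φ : Q8 ≃* Pi1 (calN r) (framePoint r p)), IsFrameIso r p φ →
        (freeClass L = H 0 ↔ φ.symm (pi1Class (loopPath L z hX)) = 1) ∧
        (freeClass L = H 1 ↔
          φ.symm (pi1Class (loopPath L z hX)) ∈ ({Q8.i, Q8.negOne * Q8.i} : Set Q8)) ∧
        (freeClass L = H 2 ↔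
          φ.symm (pi1Class (loopPath L z hX)) ∈ ({Q8.j, Q8.negOne * Q8.j} : Set Q8)) ∧
        (freeClass L = H 3 ↔
          φ.symm (pi1Class (loopPath L z hX)) ∈ ({Q8.k, Q8.negOne * Q8.k} : Set Q8)) ∧
        (freeClass L = H 4 ↔ φ.symm (pi1Class (loopPath L z hX)) = Q8.negOne)) ∧
      -- a nontrivial class is determined by its projections
      (∀ L : C(Circle, calN r), freeClass L ≠ H 0 →
        (freeClass L = H 1 ↔
          freeClass ((rho1 r).comp L) = h 0 ∧ freeClass ((rho2 r).comp L) = h 1) ∧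
        (freeClass L = H 2 ↔
          freeClass ((rho1 r).comp L) = h 1 ∧ freeClass ((rho2 r).comp L) = h 0) ∧
        (freeClass L = H 3 ↔
          freeClass ((rho1 r).comp L) = h 1 ∧ freeClass ((rho2 r).comp L) = h 1) ∧
        (freeClass L = H 4 ↔
          freeClass ((rho1 r).comp L) = h 0 ∧ freeClass ((rho2 r).comp L) = h 0)) := by
  have hr0 : r ≠ 0 := hr.ne'
  have hN := isQuotientCoveringMap_quatCover hr0
  have hP := isQuotientCoveringMap_vecCover hr0
  refine ⟨fun p => ?_, ?_⟩
  · obtain ⟨g, rfl⟩ := quatFrame_surjective p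
    exact ⟨_, isFrameIso_pi1Equiv hr0 g, fun ψ hψ => hψ.unique (isFrameIso_pi1Equiv hr0 g)⟩
  -- Loops with prescribed holonomy; those for `Q8.classRep` and `signRep` represent the classes `H`
  -- and `h`.
  choose K hK using exists_hasHolonomy_eq hN
  choose M hM using exists_hasHolonomy_eq hP
  have hNiff : ∀ {L : C(Circle, calN r)} {q : Q8}, HasHolonomy (quatCover r) L q →
      ∀ t, freeClass L = freeClass (K (Q8.classRep t)) ↔ IsConj q (Q8.classRep t) := fun hq t =>
    hN.freeClass_eq_iff_isConj exists_equivariant_isotopy_unitQuat hq (hK _)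
  have hPiff : ∀ {L : C(Circle, calP r)} {u : ℤˣ}, HasHolonomy (vecCover r) L u →
      ∀ t, freeClass L = freeClass (M (signRep t)) ↔ u = signRep t := fun hu t => by
    rw [hP.freeClass_eq_iff_isConj exists_equivariant_isotopy_unitVec hu (hM _), isConj_iff_eq]
  refine ⟨fun t => freeClass (K (Q8.classRep t)), fun t => freeClass (M (signRep t)),
    ⟨fun s t hst => ?_, fun c => ?_⟩, ⟨fun s t hst => ?_, fun c => ?_⟩, fun X => ?_, fun x => ?_,
    fun L z p hX φ hφ => ?_, fun L hL => ?_⟩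
  · have h1 := (hNiff (hK _) t).1 hst
    rw [Q8.isConj_iff] at h1
    clear hst
    revert s t
    decide
  · obtain ⟨L, rfl⟩ := Quotient.exists_rep c
    obtain ⟨q, hq⟩ := hN.exists_hasHolonomy L
    have h1 : ∀ q : Q8, ∃ t, q = Q8.classRep t ∨
        (q = Q8.negOne * Q8.classRep t ∧ Q8.classRep t ≠ 1 ∧ Q8.classRep t ≠ Q8.negOne) := by
      decide
    obtain ⟨t, ht⟩ := h1 q
    exact ⟨t, ((hNiff hq t).2 ((Q8.isConj_iff _ _).2 ht)).symm⟩
  · have h1 := (hPiff (hM _) t).1 hst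
    clear hst
    revert s t
    decide
  · obtain ⟨L, rfl⟩ := Quotient.exists_rep c
    obtain ⟨u, hu⟩ := hP.exists_hasHolonomy L
    have h1 : ∀ u : ℤˣ, ∃ t, u = signRep t := by decide
    obtain ⟨t, ht⟩ := h1 u
    exact ⟨t, ((hPiff hu t).2 ht).symm⟩
  · obtain ⟨g, rfl⟩ := hN.surjective X
    exact (hNiff (hasHolonomy_const _ g) 0).2 (IsConj.refl 1)
  · obtain ⟨v, rfl⟩ := hP.surjective x
    exact (hPiff (hasHolonomy_const _ v) 0).2 rfl
  · have hq := hNiff (hφ.hasHolonomy hr0 L z hX)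
    simp only [hq, Q8.isConj_iff, Set.mem_insert_iff, Set.mem_singleton_iff]
    -- Only the group element matters now, so the five equivalences are a finite check in `Q₈`.
    generalize φ.symm (pi1Class (loopPath L z hX)) = q
    revert q
    decide
  · obtain ⟨q, hq⟩ := hN.exists_hasHolonomy L
    have h1 := hPiff hq.rho1_comp
    have h2 := hPiff hq.rho2_comp
    have h0 := hNiff hq
    -- Everything becomes a statement about `q ≠ 1` and its two signs, again finite.
    simp only [ne_eq, h0, h1, h2, Q8.isConj_iff] at hL ⊢
    revert hL
    clear hq h0 h1 h2
    revert q
    decide
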